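/- Let $F=\bigcup_{j=1}^J\varphi_j(F)\subset\mathbb{R}^d$ ($J\ge 2$, $F$ nonempty and compact) be a self-similar fractal, where the $\varphi_j$ are similitudes of $\mathbb{R}^d$ with scaling ratios $0<r_j<1$. Let $C=[F]$ be the convex hull of $F$, and write $\Phi(C)=\bigcup_{j}\varphi_j(C)$. Assume: (a) $\dim C=d$; (b) (Tileset Condition) $\operatorname{int}C$ is a feasible open set for the open set condition, i.e. $\operatorname{int} C$ is nonempty and the sets $\varphi_j(\operatorname{int}C)$ are pairwise disjoint subsets of $\operatorname{int}C$; (c) (Nontriviality Condition) $\operatorname{int}C\nsubseteq\Phi(C)$; (d) (Pearse--Winter Condition) $\partial C\subset F$; (e) $T_0=C\setminus\Phi(C)$ has finitely many connected components $G_1,\dots,G_Q$ (the generators; in particular, there may be a single generator $G=T_0$), and each generator is a bounded open (diphase) Steiner-like set: with $g_q$ the inradius of $G_q$ (the supremum of the radii of the balls contained in $G_q$), there are real numbers $\kappa_m(G_q)$ such that $$V^-_{G_q}(\varepsilon):=\operatorname{vol}\{x\in\overline{G_q} : \operatorname{dist}(x,G_q^c)\le\varepsilon\}=\sum_{m=0}^{d-1}\kappa_m(G_q)\,\varepsilon^{d-m}\quad(0<\varepsilon<g_q),\qquad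 \kappa_d(G_q):=-\operatorname{vol}(G_q);$$ (f) $D>d-1$, where, with $V_F(\varepsilon)=\operatorname{vol}\{x:\operatorname{dist}(x,F)\le\varepsilon\}$, $D=\inf\{t\ge0 : V_F(\varepsilon)=O(\varepsilon^{d-t})\text{ as }\varepsilon\to0^+\}$ is the Minkowski dimension of $F$. Let $\zeta(s)=1/\bigl(1-\sum_{j}r_j^s\bigr)$ be the scaling zeta function, i.e. the meromorphic extension of $\sum_{n\ge0}\sum_{w\in\{1,\dots,J\}^n}(r_{w_1}\cdots r_{w_n})^s$ from $\operatorname{Re}s>D$ to $\mathbb{C}$, and put $$\zeta^q_{\mathcal T}(s,\varepsilon)=\zeta(s)\,\varepsilon^{d-s}\sum_{m=0}^d\frac{g_q^{s-m}}{s-m}\kappa_m(G_q),\qquad \zeta_{\mathcal T}=\sum_{q=1}^Q\zeta^q_{\mathcal T}.$$ Then $\sum_{j=1}^J r_j^D=1$ and $D=\lim_{\varepsilon\to0^+}\bigl(d-\log V_F(\varepsilon)/\log\varepsilon\bigr)$. Moreover, the residue $M:=\operatorname{res}(\zeta_{\mathcal T}(s,\varepsilon)\,\varepsilon^{s-d};D)$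 is a real number that does not depend on $\varepsilon>0$ and is given by $$M=\sum_{q=1}^Q\operatorname{res}\bigl(\zeta^q_{\mathcal T}(s,\varepsilon)\,\varepsilon^{s-d};D\bigr)=\operatorname{res}(\zeta;D)\sum_{q=1}^Q\sum_{m=0}^d\frac{g_q^{D-m}}{D-m}\kappa_m(G_q)=\frac{\sum_{q=1}^Q\sum_{m=0}^d\frac{g_q^{D-m}}{D-m}\kappa_m(G_q)}{\sum_{j=1}^J r_j^D\log r_j^{-1}},$$ and the following hold. I. If the IFS is of non-lattice type (the additive group generated by the numbers $\log r_j$ is not discrete), then $F$ is Minkowski measurable with Minkowski content $M$: $\lim_{\varepsilon\to0^+}V_F(\varepsilon)\,\varepsilon^{D-d}=M\neq0$. II. If the IFS is of lattice type (this group is discrete), then $F$ is not Minkowski measurable, i.e. $V_F(\varepsilon)\,\varepsilon^{D-d}$ has no finite nonzero limit as $\varepsilon\to0^+$; but its average Minkowski content exists and equals $M$: $$\lim_{T\to\infty}\frac1{\log T}\int_{1/T}^1\varepsilon^{-(d-D)}\,V_F(\varepsilon)\,\frac{d\varepsilon}{\varepsilon}=M.$$ -/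

import Mathlib

open Set Filter Topology MeasureTheory

noncomputable section

namespace Fractal

/-- `d`-dimensional Euclidean space. -/
abbrev Euc (d : ℕ) : Type := EuclideanSpace ℝ (Fin d)

/-! ## Self-similar sets -/

/-- A similitude of `ℝ^d` with scaling ratio `r`, where `0 < r < 1`. -/
def IsSimilitude {d : ℕ} (φ : Euc d → Euc d) (r : ℝ) : Prop :=
  0 < r ∧ r < 1 ∧ ∀ x y, dist (φ x) (φ y) = r * dist x y

/-- `F` is the self-similar fractal of the IFS `φ`: the nonempty compact set with
`F = ⋃ j, φ j (F)`. -/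
def IsAttractor {d J : ℕ} (φ : Fin J → Euc d → Euc d) (F : Set (Euc d)) : Prop :=
  F.Nonempty ∧ IsCompact F ∧ F = ⋃ j, φ j '' F

/-- `O` is a feasible open set for the open set condition of the IFS `φ`. -/
def IsFeasibleOpenSet {d J : ℕ} (φ : Fin J → Euc d → Euc d) (O : Set (Euc d)) : Prop :=
  IsOpen O ∧ O.Nonempty ∧ (∀ j, φ j '' O ⊆ O) ∧
    Pairwise (fun j k => Disjoint (φ j '' O) (φ k '' O))

/-- Tileset condition: the interior of the convex hull `C` of `F` is a feasible open set. -/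
def TilesetCondition {d J : ℕ} (φ : Fin J → Euc d → Euc d) (F : Set (Euc d)) : Prop :=
  IsFeasibleOpenSet φ (interior (convexHull ℝ F))

/-- Nontriviality condition: `int C` is not contained in `⋃ j, φ j (C)`. -/
def NontrivialityCondition {d J : ℕ} (φ : Fin J → Euc d → Euc d) (F : Set (Euc d)) : Prop :=
  ¬ interior (convexHull ℝ F) ⊆ ⋃ j, φ j '' convexHull ℝ F

/-- Pearse–Winter condition: the boundary of `C` is contained in `F`. -/
def PearseWinterCondition {d : ℕ} (F : Set (Euc d)) : Prop :=
  frontier (convexHull ℝ F) ⊆ F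

/-- The IFS with scaling ratios `r j` is of lattice type: the additive subgroup of `ℝ`
generated by the numbers `log (r j)` is discrete. -/
def IsLatticeType {J : ℕ} (r : Fin J → ℝ) : Prop :=
  DiscreteTopology (AddSubgroup.closure (Set.range fun j => Real.log (r j)))

/-! ## Minkowski dimension and content -/

/-- The volume `V_A(ε)` of the `ε`-neighbourhood `{x | dist (x, A) ≤ ε}`. -/
def tubeVolume {d : ℕ} (A : Set (Euc d)) (ε : ℝ) : ℝ :=
  volume.real (Metric.cthickening ε A)

/-- The (upper) Minkowski dimension
`inf {t ≥ 0 | V_A(ε) = O(ε ^ (d - t)) as ε → 0+}`. -/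
def minkowskiDim {d : ℕ} (A : Set (Euc d)) : ℝ :=
  sInf {t : ℝ | 0 ≤ t ∧
    (fun ε => tubeVolume A ε) =O[𝓝[>] 0] fun ε : ℝ => ε ^ ((d : ℝ) - t)}

/-- `A` is Minkowski measurable with Minkowski content `M`. -/
def HasMinkowskiContent {d : ℕ} (A : Set (Euc d)) (M : ℝ) : Prop :=
  M ≠ 0 ∧
    Tendsto (fun ε : ℝ => tubeVolume A ε * ε ^ (minkowskiDim A - d)) (𝓝[>] 0) (𝓝 M)

/-- `A` is Minkowski measurable. -/
def IsMinkowskiMeasurable {d : ℕ} (A : Set (Euc d)) : Prop :=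
  ∃ M : ℝ, HasMinkowskiContent A M

/-- The average Minkowski content of `A` exists and equals `M`. -/
def HasAverageMinkowskiContent {d : ℕ} (A : Set (Euc d)) (M : ℝ) : Prop :=
  Tendsto (fun T : ℝ => 1 / Real.log T *
      ∫ ε in (1 / T)..1, ε ^ (-((d : ℝ) - minkowskiDim A)) * tubeVolume A ε / ε)
    atTop (𝓝 M)

/-! ## Generators -/

/-- The volume `V⁻_A(ε)` of the inner `ε`-neighbourhood `{x ∈ closure A | dist (x, Aᶜ) ≤ ε}`. -/
def innerTubeVolume {d : ℕ} (A : Set (Euc d)) (ε : ℝ) : ℝ :=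
  volume.real (closure A ∩ Metric.cthickening ε Aᶜ)

/-- The inradius: the supremum of the radii of the balls contained in `A`. -/
def inradius {d : ℕ} (A : Set (Euc d)) : ℝ :=
  sSup {ρ : ℝ | 0 < ρ ∧ ∃ x, Metric.ball x ρ ⊆ A}

/-- `G` is a (diphase) Steiner-like set with coefficients `κ 0, …, κ d`; the last one is
minus the volume of `G`. -/
def IsSteinerLike {d : ℕ} (G : Set (Euc d)) (κ : ℕ → ℝ) : Prop :=
  Bornology.IsBounded G ∧ IsOpen G ∧
    (∀ ε : ℝ, 0 < ε → ε < inradius G →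
      innerTubeVolume G ε = ∑ m ∈ Finset.range d, κ m * ε ^ (d - m)) ∧
    κ d = -volume.real G

/-- The sets `G q` are the generators of the tiling: they are the finitely many connected
components of the open set `T₀ = C \ ⋃ j, φ j (C)`, i.e. open, connected, pairwise disjoint
sets with union `T₀`. -/
def AreGenerators {d J Q : ℕ} (φ : Fin J → Euc d → Euc d) (F : Set (Euc d))
    (G : Fin Q → Set (Euc d)) : Prop :=
  (∀ q, IsOpen (G q)) ∧ (∀ q, IsConnected (G q)) ∧
    Pairwise (fun q q' => Disjoint (G q) (G q')) ∧
    ⋃ q, G q = convexHull ℝ F \ ⋃ j, φ j '' convexHull ℝ F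

/-! ## Zeta functions and residues -/

/-- The scaling zeta function of the ratios `r j`: the meromorphic extension to `ℂ` of
`∑ n, ∑ w, (r_{w_1} ⋯ r_{w_n}) ^ s`, the inner sum being over the words of length `n`; see
`hasSum_scalingZeta` and `meromorphicAt_scalingZeta`. -/
def scalingZeta {J : ℕ} (r : Fin J → ℝ) (s : ℂ) : ℂ :=
  1 / (1 - ∑ j, (r j : ℂ) ^ s)

theorem meromorphicAt_scalingZeta {J : ℕ} {r : Fin J → ℝ} (hr : ∀ j, 0 < r j) (s : ℂ) :
    MeromorphicAt (scalingZeta r) s := by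
  have h : Differentiable ℂ fun z : ℂ => 1 - ∑ j, (r j : ℂ) ^ z := by
    refine (differentiable_const _).sub (Differentiable.fun_sum fun j _ => ?_)
    exact differentiable_id.const_cpow (Or.inl (by exact_mod_cast (hr j).ne'))
  exact (MeromorphicAt.const 1 s).div (h.analyticAt s).meromorphicAt

theorem hasSum_scalingZeta {J : ℕ} [NeZero J] {r : Fin J → ℝ} (hr : ∀ j, 0 < r j)
    (hr1 : ∀ j, r j < 1) {D : ℝ} (hD : ∑ j, r j ^ D = 1) {s : ℂ} (hs : D < s.re) :
    HasSum (fun n : ℕ => ∑ w : Fin n → Fin J, ((∏ i, r (w i) : ℝ) : ℂ) ^ s)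
      (scalingZeta r s) := by
  have hterm : ∀ n : ℕ, ∑ w : Fin n → Fin J, ((∏ i, r (w i) : ℝ) : ℂ) ^ s
      = (∑ j, (r j : ℂ) ^ s) ^ n := by
    intro n
    rw [Fintype.sum_pow]
    refine Finset.sum_congr rfl fun w _ => ?_
    rw [Complex.ofReal_prod]
    generalize (Finset.univ : Finset (Fin n)) = S
    induction S using Finset.cons_induction with
    | empty => simp
    | cons a S ha ih =>
      rw [Finset.prod_cons, Finset.prod_cons, ← Complex.ofReal_prod,
        Complex.mul_cpow_ofReal_nonneg (hr _).le (Finset.prod_nonneg fun i _ => (hr _).le),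
        Complex.ofReal_prod, ih]
  have hlt : ‖∑ j, (r j : ℂ) ^ s‖ < 1 := by
    refine (norm_sum_le _ _).trans_lt ?_
    rw [← hD]
    refine Finset.sum_lt_sum_of_nonempty ⟨0, Finset.mem_univ _⟩ fun j _ => ?_
    rw [Complex.norm_cpow_eq_rpow_re_of_pos (hr j)]
    exact Real.rpow_lt_rpow_of_exponent_gt (hr j) (hr1 j) hs
  simp_rw [hterm, scalingZeta, one_div]
  exact hasSum_geometric_of_norm_lt_one hlt

/-- The geometric zeta function
`ζ_T(s, ε) = ζ(s) ε ^ (d - s) ∑_{m = 0}^{d} g ^ (s - m) / (s - m) κ_m(G)`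
associated with a generator `G` with inradius `g`. -/
def geometricZeta {d J : ℕ} (r : Fin J → ℝ) (G : Set (Euc d)) (κ : ℕ → ℝ)
    (s : ℂ) (ε : ℝ) : ℂ :=
  scalingZeta r s * (ε : ℂ) ^ ((d : ℂ) - s) *
    ∑ m ∈ Finset.range (d + 1), (inradius G : ℂ) ^ (s - m) / (s - m) * (κ m : ℂ)

/-- The total geometric zeta function: the sum of those of the generators. -/
def totalGeometricZeta {d J Q : ℕ} (r : Fin J → ℝ) (G : Fin Q → Set (Euc d))
    (κ : Fin Q → ℕ → ℝ) (s : ℂ) (ε : ℝ) : ℂ :=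
  ∑ q, geometricZeta r (G q) (κ q) s ε

/-- `f` is meromorphic at `a` and has residue `c` there: `(2πi)⁻¹ ∮ f = c` over all
sufficiently small circles around `a`. -/
def HasResidueAt (f : ℂ → ℂ) (a c : ℂ) : Prop :=
  MeromorphicAt f a ∧
    ∀ᶠ ρ : ℝ in 𝓝[>] 0, (2 * (Real.pi : ℂ) * Complex.I)⁻¹ * (∮ z in C(a, ρ), f z) = c

end Fractal

end

/-! Inside the hull `C` of `F`, the Pearse–Winter condition turns the distance to `F` of a point of
a generator into its distance to the complement of that generator, so that the volume `f ε` of the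
part of the `ε`-neighbourhood of `F` lying in `C` satisfies
`f ε = ∑ q, V⁻_{G q} ε + ∑ j, r j ^ d * f (ε / r j)`. Outside `C` the neighbourhoods of `F` and of
the convex set `C` agree; this contributes `O(ε)`, which is negligible as `D > d - 1`.

In the variable `t = -log ε` this becomes a renewal equation `Z t = z t + ∑ j, p j * Z (t - a j)`
for `Z t = exp ((d - D) * t) * f (exp (-t))`, with weights `p j = r j ^ D` of sum `1` and steps
`a j = log (r j)⁻¹`. The mass `∑ j, p j * ∫ Z` over the windows `[t - a j, t]` has derivative `z`,
hence tends to `∫ z`, which is the numerator of the residue; this yields the average content.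

If the steps generate a dense group, then where `Z` nearly attains its limit superior it does so
too after subtracting any element of the semigroup of steps; this semigroup is eventually
`δ`-dense, and `Z` increases only slowly, so that `Z` is close to its limit superior on whole
windows. The limit of the mass identifies the limit superior, and likewise the limit inferior. In
the lattice case, `z` is piecewise a combination of exponentials which a suitable combination of
small translations annihilates; the same combination of translates of `Z` then vanishes along a
lattice, and this is incompatible with a nonzero limit of `Z`. -/

open scoped Pointwise

namespace Fractal

/-! ### Similitudes -/

namespace IsSimilitude

variable {d : ℕ} {φ : Euc d → Euc d} {r : ℝ}

theorem exists_linearIsometryEquiv (h : IsSimilitude φ r) :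
    ∃ (L : Euc d ≃ₗᵢ[ℝ] Euc d) (c : Euc d), ∀ x, φ x = c + r • L x := by
  obtain ⟨hr0, -, hd⟩ := h
  have hiso : Isometry fun x => r⁻¹ • φ x := by
    refine Isometry.of_dist_eq fun x y => ?_
    rw [dist_smul₀, hd, Real.norm_of_nonneg (inv_nonneg.2 hr0.le), inv_mul_cancel_left₀ hr0.ne']
  set A := hiso.affineIsometryOfStrictConvexSpace
  refine ⟨A.linearIsometry.toLinearIsometryEquiv rfl, φ 0, fun x => ?_⟩
  have hA : r⁻¹ • φ x = A.linearIsometry x + r⁻¹ • φ 0 :=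
    (congrArg A (add_zero x).symm).trans (A.map_vadd 0 x)
  calc φ x = r • (r⁻¹ • φ x) := (smul_inv_smul₀ hr0.ne' _).symm
    _ = φ 0 + r • A.linearIsometry x := by
      rw [hA, smul_add, smul_inv_smul₀ hr0.ne', add_comm]

theorem exists_homeomorph (h : IsSimilitude φ r) : ∃ e : Euc d ≃ₜ Euc d, ⇑e = φ := by
  obtain ⟨L, c, hL⟩ := h.exists_linearIsometryEquiv
  refine ⟨(L.toHomeomorph.trans (Homeomorph.smulOfNeZero r h.1.ne')).trans
    (Homeomorph.addLeft c), ?_⟩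
  ext1 x
  simp [hL]

theorem injective (h : IsSimilitude φ r) : Function.Injective φ := by
  obtain ⟨e, rfl⟩ := h.exists_homeomorph
  exact e.injective

theorem image_interior (h : IsSimilitude φ r) (s : Set (Euc d)) :
    φ '' interior s = interior (φ '' s) := by
  obtain ⟨e, rfl⟩ := h.exists_homeomorph
  exact e.image_interior s

theorem image_frontier (h : IsSimilitude φ r) (s : Set (Euc d)) :
    φ '' frontier s = frontier (φ '' s) := by
  obtain ⟨e, rfl⟩ := h.exists_homeomorph
  exact e.image_frontier s

theorem image_convexHull (h : IsSimilitude φ r) (s : Set (Euc d)) :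
    φ '' convexHull ℝ s = convexHull ℝ (φ '' s) := by
  obtain ⟨L, c, hL⟩ := h.exists_linearIsometryEquiv
  let A : Euc d →ᵃ[ℝ] Euc d :=
    AffineMap.const ℝ (Euc d) c + (r • (L.toLinearEquiv : Euc d →ₗ[ℝ] Euc d)).toAffineMap
  have hA : ⇑A = φ := by
    ext1 x
    simp [A, hL]
  rw [← hA, A.image_convexHull]

theorem volumeReal_image (h : IsSimilitude φ r) (s : Set (Euc d)) :
    volume.real (φ '' s) = r ^ d * volume.real s := by
  obtain ⟨L, c, hL⟩ := h.exists_linearIsometryEquiv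
  have hs : φ '' s = c +ᵥ r • (L '' s) := by
    rw [← image_smul, ← image_vadd, image_image, image_image]
    exact image_congr fun x _ => hL x
  have hLs : volume (L '' s) = volume s := by
    rw [LinearIsometryEquiv.image_eq_preimage_symm]
    exact L.symm.measurePreserving.measure_preimage_emb
      L.symm.toHomeomorph.measurableEmbedding s
  have hr : 0 ≤ r ^ d := pow_nonneg h.1.le d
  rw [Measure.real, hs, measure_vadd, Measure.addHaar_smul, hLs, finrank_euclideanSpace,
    Fintype.card_fin, abs_of_nonneg hr, ENNReal.toReal_mul, ENNReal.toReal_ofReal hr, Measure.real]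

theorem infEDist_image (h : IsSimilitude φ r) (s : Set (Euc d)) (x : Euc d) :
    Metric.infEDist (φ x) (φ '' s) = ENNReal.ofReal r * Metric.infEDist x s := by
  have hed : ∀ y, edist (φ x) (φ y) = ENNReal.ofReal r * edist x y := fun y => by
    rw [edist_dist, h.2.2, ENNReal.ofReal_mul h.1.le, edist_dist]
  have hr : ENNReal.ofReal r ≠ 0 := by simpa using h.1
  simp only [Metric.infEDist, iInf_image, hed, ENNReal.mul_iInf_of_ne hr ENNReal.ofReal_ne_top]

theorem image_cthickening (h : IsSimilitude φ r) (s : Set (Euc d)) (ε : ℝ) :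
    φ '' Metric.cthickening (ε / r) s = range φ ∩ Metric.cthickening ε (φ '' s) := by
  have hr : ENNReal.ofReal r ≠ 0 := by simpa using h.1
  have hε : ENNReal.ofReal ε = ENNReal.ofReal r * ENNReal.ofReal (ε / r) := by
    rw [← ENNReal.ofReal_mul h.1.le, mul_div_cancel₀ _ h.1.ne']
  rw [← image_preimage_eq_range_inter]
  congr 1 with x
  rw [mem_preimage, Metric.mem_cthickening_iff, Metric.mem_cthickening_iff, h.infEDist_image, hε,
    ENNReal.mul_le_mul_iff_right hr ENNReal.ofReal_ne_top]

end IsSimilitude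

/-! ### Distances and tubes in a finite-dimensional normed space -/

section NormedSpace

variable {E : Type*} [NormedAddCommGroup E] [NormedSpace ℝ E]

theorem infEDist_le_edist_of_frontier_subset [FiniteDimensional ℝ E] {S A : Set E}
    (h : frontier S ⊆ A) {x y : E} (hx : x ∈ S) (hy : y ∉ interior S) :
    Metric.infEDist x A ≤ edist x y := by
  by_cases hyS : y ∈ S
  · exact Metric.infEDist_le_edist_of_mem (h ⟨subset_closure hyS, hy⟩)
  · obtain ⟨z, hz, hzd⟩ := exists_mem_frontier_infDist_compl_eq_dist hx
      (fun hu => hyS (hu ▸ mem_univ y))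
    refine (Metric.infEDist_le_edist_of_mem (h hz)).trans ?_
    rw [edist_dist, edist_dist, ← hzd]
    exact ENNReal.ofReal_le_ofReal (Metric.infDist_le_dist_of_mem hyS)

theorem inter_cthickening_eq_of_frontier_subset [FiniteDimensional ℝ E] {S A B : Set E}
    (h : frontier S ⊆ A) (hAB : A ⊆ B) (hB : ∀ y ∈ B, y ∈ A ∨ y ∉ interior S) (ε : ℝ) :
    S ∩ Metric.cthickening ε B = S ∩ Metric.cthickening ε A := by
  refine subset_antisymm (fun x hx => ⟨hx.1, ?_⟩)
    (inter_subset_inter_right _ (Metric.cthickening_subset_of_subset _ hAB))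
  refine le_trans (Metric.le_infEDist.2 fun y hy => ?_) hx.2
  exact (hB y hy).elim Metric.infEDist_le_edist_of_mem
    (infEDist_le_edist_of_frontier_subset h hx.1)

theorem vadd_cthickening_subset_smul {C : Set E} (hC : Convex ℝ C) (hcomp : IsCompact C)
    {x₀ : E} {ρ ε : ℝ} (hρ : 0 < ρ) (hball : Metric.closedBall x₀ ρ ⊆ C) (hε : 0 ≤ ε) :
    (ε / ρ) • x₀ +ᵥ Metric.cthickening ε C ⊆ (1 + ε / ρ) • C := by
  have hsmul : (ε / ρ) • Metric.closedBall x₀ ρ = Metric.closedBall ((ε / ρ) • x₀) ε := by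
    rw [smul_closedBall _ _ hρ.le, Real.norm_of_nonneg (by positivity), div_mul_cancel₀ _ hρ.ne']
  calc (ε / ρ) • x₀ +ᵥ Metric.cthickening ε C
      = C + (ε / ρ) • Metric.closedBall x₀ ρ := by
        rw [hsmul, hcomp.add_closedBall hε]
    _ ⊆ C + (ε / ρ) • C := add_subset_add_left (smul_set_mono hball)
    _ = (1 + ε / ρ) • C := by rw [hC.add_smul zero_le_one (by positivity), one_smul]

theorem one_add_mul_pow_le {u : ℝ} (hu : 0 ≤ u) (n : ℕ) {ε : ℝ} (h0 : 0 ≤ ε) (h1 : ε ≤ 1) :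
    (1 + ε * u) ^ n ≤ 1 + ε * ((1 + u) ^ n - 1) := by
  have h := (convexOn_pow n).2 (mem_Ici.2 zero_le_one) (mem_Ici.2 (by positivity : 0 ≤ 1 + u))
    (sub_nonneg.2 h1) h0 (sub_add_cancel 1 ε)
  simp only [smul_eq_mul, one_pow, mul_one] at h
  calc (1 + ε * u) ^ n = (1 - ε + ε * (1 + u)) ^ n := by ring
    _ ≤ 1 - ε + ε * (1 + u) ^ n := h
    _ = 1 + ε * ((1 + u) ^ n - 1) := by ring

theorem exists_measureReal_cthickening_le [FiniteDimensional ℝ E] [MeasurableSpace E]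
    [BorelSpace E] (μ : Measure E) [μ.IsAddHaarMeasure] {C : Set E} (hC : Convex ℝ C)
    (hcomp : IsCompact C) (hint : (interior C).Nonempty) :
    ∃ K : ℝ, ∀ ε : ℝ, 0 ≤ ε → ε ≤ 1 → μ.real (Metric.cthickening ε C) ≤ μ.real C + K * ε := by
  obtain ⟨x₀, hx₀⟩ := hint
  obtain ⟨ρ, hρ, hball⟩ := Metric.nhds_basis_closedBall.mem_iff.1 (mem_interior_iff_mem_nhds.1 hx₀)
  set n := Module.finrank ℝ E
  refine ⟨((1 + ρ⁻¹) ^ n - 1) * μ.real C, fun ε h0 h1 => ?_⟩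
  have hpow : 0 ≤ (1 + ε / ρ) ^ n := by positivity
  have hsmul : μ.real ((1 + ε / ρ) • C) = (1 + ε / ρ) ^ n * μ.real C := by
    rw [Measure.real, Measure.addHaar_smul, abs_of_nonneg hpow, ENNReal.toReal_mul,
      ENNReal.toReal_ofReal hpow, Measure.real]
  calc μ.real (Metric.cthickening ε C)
      = μ.real ((ε / ρ) • x₀ +ᵥ Metric.cthickening ε C) := by
        rw [Measure.real, Measure.real, measure_vadd]
    _ ≤ (1 + ε / ρ) ^ n * μ.real C := by
        rw [← hsmul]
        exact measureReal_mono (vadd_cthickening_subset_smul hC hcomp hρ hball h0)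
          (hcomp.smul _).measure_lt_top.ne
    _ ≤ (1 + ε * ((1 + ρ⁻¹) ^ n - 1)) * μ.real C := by
        gcongr
        exact one_add_mul_pow_le (inv_nonneg.2 hρ.le) n h0 h1
    _ = μ.real C + ((1 + ρ⁻¹) ^ n - 1) * μ.real C * ε := by ring

end NormedSpace

/-! ### The tiling of the convex hull -/

section Hull

variable {d J Q : ℕ} {φ : Fin J → Euc d → Euc d} {r : Fin J → ℝ} {F : Set (Euc d)}
  {G : Fin Q → Set (Euc d)}

/-- A partition of `T₀ = C \ ⋃ j, φ j (C)` into finitely many nonempty open sets. The pieces need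
not be connected: when `T₀` is open and nonempty, it is the only piece of such a partition. -/
structure IsOpenPartition (φ : Fin J → Euc d → Euc d) (F : Set (Euc d))
    (G : Fin Q → Set (Euc d)) : Prop where
  isOpen : ∀ q, IsOpen (G q)
  nonempty : ∀ q, (G q).Nonempty
  pairwise_disjoint : Pairwise fun q q' => Disjoint (G q) (G q')
  iUnion_eq : ⋃ q, G q = convexHull ℝ F \ ⋃ j, φ j '' convexHull ℝ F

theorem AreGenerators.isOpenPartition (hG : AreGenerators φ F G) : IsOpenPartition φ F G where
  isOpen := hG.1
  nonempty q := (hG.2.1 q).nonempty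
  pairwise_disjoint := hG.2.2.1
  iUnion_eq := hG.2.2.2

theorem PearseWinterCondition.isCompact_convexHull (hPWC : PearseWinterCondition F)
    (hF : Bornology.IsBounded F) : IsCompact (convexHull ℝ F) := by
  refine Metric.isCompact_of_isClosed_isBounded (closure_subset_iff_isClosed.1 ?_)
    (isBounded_convexHull.2 hF)
  rw [closure_eq_self_union_frontier]
  exact union_subset subset_rfl (hPWC.trans (subset_convexHull ℝ F))

theorem PearseWinterCondition.frontier_image_subset (hPWC : PearseWinterCondition F)
    (hφ : ∀ j, IsSimilitude (φ j) (r j)) (j : Fin J) :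
    frontier (φ j '' convexHull ℝ F) ⊆ φ j '' F := by
  rw [← (hφ j).image_frontier]
  exact image_mono hPWC

theorem IsAttractor.image_subset (hF : IsAttractor φ F) (j : Fin J) : φ j '' F ⊆ F := by
  conv_rhs => rw [hF.2.2]
  exact subset_iUnion (fun j => φ j '' F) j

theorem IsAttractor.exists_mem_image (hF : IsAttractor φ F) {x : Euc d} (hx : x ∈ F) :
    ∃ j, x ∈ φ j '' F :=
  mem_iUnion.1 (hF.2.2.le hx)

theorem IsAttractor.image_convexHull_subset (hF : IsAttractor φ F)
    (hφ : ∀ j, IsSimilitude (φ j) (r j)) (j : Fin J) :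
    φ j '' convexHull ℝ F ⊆ convexHull ℝ F := by
  rw [(hφ j).image_convexHull]
  exact convexHull_mono (hF.image_subset j)

theorem TilesetCondition.disjoint_interior_image (hTSC : TilesetCondition φ F)
    (hφ : ∀ j, IsSimilitude (φ j) (r j)) {j k : Fin J} (hjk : j ≠ k) :
    Disjoint (φ k '' convexHull ℝ F) (interior (φ j '' convexHull ℝ F)) := by
  have hint : (interior (φ k '' convexHull ℝ F)).Nonempty := by
    rw [← (hφ k).image_interior]
    exact hTSC.2.1.image _
  have hconv : Convex ℝ (φ k '' convexHull ℝ F) := by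
    rw [(hφ k).image_convexHull]
    exact convex_convexHull ℝ _
  have hclosure : φ k '' convexHull ℝ F ⊆ closure (interior (φ k '' convexHull ℝ F)) := by
    rw [hconv.closure_interior_eq_closure_of_nonempty_interior hint]
    exact subset_closure
  have hdisj := hTSC.2.2.2 hjk
  simp only [(hφ _).image_interior] at hdisj
  exact ((hdisj.closure_right isOpen_interior).mono_right hclosure).symm

theorem TilesetCondition.dim_pos (hTSC : TilesetCondition φ F) (hJ : 2 ≤ J) : 0 < d := by
  rcases Nat.eq_zero_or_pos d with rfl | h
  · obtain ⟨x, hx⟩ := hTSC.2.1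
    have hne : (⟨0, by omega⟩ : Fin J) ≠ ⟨1, by omega⟩ := by simp
    exact absurd ⟨x, hx, Subsingleton.elim _ _⟩
      (disjoint_left.1 (hTSC.2.2.2 hne) (mem_image_of_mem _ hx))
  · exact h

theorem volume_frontier_image_convexHull (hφ : ∀ j, IsSimilitude (φ j) (r j)) (j : Fin J) :
    volume (frontier (φ j '' convexHull ℝ F)) = 0 := by
  rw [(hφ j).image_convexHull]
  exact (convex_convexHull ℝ _).addHaar_frontier volume

theorem volumeReal_iUnion_image_inter (hφ : ∀ j, IsSimilitude (φ j) (r j))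
    (hTSC : TilesetCondition φ F) (hC : IsCompact (convexHull ℝ F)) {A : Set (Euc d)}
    (hA : MeasurableSet A) :
    volume.real ((⋃ j, φ j '' convexHull ℝ F) ∩ A) =
      ∑ j, volume.real (φ j '' convexHull ℝ F ∩ A) := by
  have hcompact (j : Fin J) : IsCompact (φ j '' convexHull ℝ F) := by
    obtain ⟨e, he⟩ := (hφ j).exists_homeomorph
    exact hC.image (he ▸ e.continuous)
  have hdisj : Pairwise fun j k =>
      AEDisjoint volume (φ j '' convexHull ℝ F ∩ A) (φ k '' convexHull ℝ F ∩ A) := by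
    refine fun j k hjk => measure_mono_null ?_ (volume_frontier_image_convexHull (F := F) hφ j)
    exact fun x hx => ⟨subset_closure hx.1.1,
      disjoint_left.1 (hTSC.disjoint_interior_image hφ hjk) hx.2.1⟩
  have h := measureReal_biUnion_finset₀ (s := Finset.univ) (hdisj.set_pairwise _)
    (fun j _ => ((hcompact j).measurableSet.inter hA).nullMeasurableSet)
    (fun j _ => measure_ne_top_of_subset inter_subset_left (hcompact j).measure_lt_top.ne)
  simpa only [Finset.mem_univ, iUnion_true, ← iUnion_inter] using h

namespace IsOpenPartition

theorem subset_convexHull (hG : IsOpenPartition φ F G) (q : Fin Q) : G q ⊆ convexHull ℝ F :=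
  (subset_iUnion G q).trans (hG.iUnion_eq.le.trans sdiff_subset)

theorem isBounded (hG : IsOpenPartition φ F G) (hF : Bornology.IsBounded F) (q : Fin Q) :
    Bornology.IsBounded (G q) :=
  (isBounded_convexHull.2 hF).subset (hG.subset_convexHull q)

theorem disjoint_image (hG : IsOpenPartition φ F G) (q : Fin Q) (j : Fin J) :
    Disjoint (G q) (φ j '' convexHull ℝ F) :=
  disjoint_left.2 fun _ hx hxj =>
    (hG.iUnion_eq.le (mem_iUnion_of_mem q hx)).2 (mem_iUnion_of_mem j hxj)

theorem subset_compl (hG : IsOpenPartition φ F G) (hF : IsAttractor φ F) (q : Fin Q) :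
    F ⊆ (G q)ᶜ := by
  intro x hx hxG
  obtain ⟨j, hj⟩ := hF.exists_mem_image hx
  exact disjoint_left.1 (hG.disjoint_image q j) hxG (image_mono (_root_.subset_convexHull ℝ F) hj)

theorem nonempty_index (hG : IsOpenPartition φ F G) (hNTC : NontrivialityCondition φ F) :
    Nonempty (Fin Q) := by
  obtain ⟨x, hx, hxn⟩ := not_subset.1 hNTC
  obtain ⟨q, -⟩ := mem_iUnion.1 (hG.iUnion_eq.ge ⟨interior_subset hx, hxn⟩)
  exact ⟨q⟩

theorem frontier_subset (hG : IsOpenPartition φ F G) (hC : IsClosed (convexHull ℝ F))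
    (q : Fin Q) : frontier (G q) ⊆ ⋃ j, frontier (φ j '' convexHull ℝ F) := by
  intro x hx
  have hxC : x ∈ convexHull ℝ F := closure_minimal (hG.subset_convexHull q) hC hx.1
  have hxG : x ∉ ⋃ q, G q := by
    rintro hmem
    obtain ⟨q', hq'⟩ := mem_iUnion.1 hmem
    rcases eq_or_ne q' q with rfl | hne
    · exact hx.2 (by rwa [(hG.isOpen q').interior_eq])
    · exact disjoint_left.1 ((hG.pairwise_disjoint hne).closure_right (hG.isOpen q')) hq' hx.1
  obtain ⟨j, hj⟩ := mem_iUnion.1 (not_not.1 fun hcon => hxG (hG.iUnion_eq.ge ⟨hxC, hcon⟩))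
  refine mem_iUnion_of_mem j ⟨subset_closure hj, fun hint => ?_⟩
  exact disjoint_left.1 (((hG.disjoint_image q j).mono_right interior_subset).closure_left
    isOpen_interior) hx.1 hint

theorem volume_frontier (hG : IsOpenPartition φ F G) (hφ : ∀ j, IsSimilitude (φ j) (r j))
    (hC : IsClosed (convexHull ℝ F)) (q : Fin Q) : volume (frontier (G q)) = 0 :=
  measure_mono_null (hG.frontier_subset hC q)
    (measure_iUnion_null (volume_frontier_image_convexHull hφ))

theorem volumeReal_pos (hG : IsOpenPartition φ F G) (hF : Bornology.IsBounded F) (q : Fin Q) :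
    0 < volume.real (G q) :=
  ENNReal.toReal_pos ((hG.isOpen q).measure_pos volume (hG.nonempty q)).ne'
    (hG.isBounded hF q).measure_lt_top.ne

theorem volumeReal_convexHull_inter (hG : IsOpenPartition φ F G)
    (hφ : ∀ j, IsSimilitude (φ j) (r j)) (hF : IsAttractor φ F) (hTSC : TilesetCondition φ F)
    (hC : IsCompact (convexHull ℝ F)) {A : Set (Euc d)} (hA : MeasurableSet A) :
    volume.real (convexHull ℝ F ∩ A) =
      ∑ q, volume.real (G q ∩ A) + ∑ j, volume.real (φ j '' convexHull ℝ F ∩ A) := by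
  have hfinite {B : Set (Euc d)} (hB : B ⊆ convexHull ℝ F ∩ A) : volume B ≠ ⊤ :=
    measure_ne_top_of_subset (hB.trans inter_subset_left) hC.measure_lt_top.ne
  have hunion : convexHull ℝ F ∩ A = (⋃ q, G q ∩ A) ∪ (⋃ j, φ j '' convexHull ℝ F) ∩ A := by
    rw [← iUnion_inter, hG.iUnion_eq, ← union_inter_distrib_right,
      sdiff_union_of_subset (iUnion_subset (hF.image_convexHull_subset hφ))]
  have hdisj : Disjoint (⋃ q, G q ∩ A) ((⋃ j, φ j '' convexHull ℝ F) ∩ A) := by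
    rw [← iUnion_inter, hG.iUnion_eq]
    exact disjoint_sdiff_left.mono inter_subset_left inter_subset_left
  have hmeas (q : Fin Q) : MeasurableSet (G q ∩ A) := (hG.isOpen q).measurableSet.inter hA
  calc volume.real (convexHull ℝ F ∩ A)
      = volume.real (⋃ q, G q ∩ A) + volume.real ((⋃ j, φ j '' convexHull ℝ F) ∩ A) := by
        rw [hunion, measureReal_union' hdisj (MeasurableSet.iUnion hmeas)
          (hfinite (hunion ▸ subset_union_left)) (hfinite (hunion ▸ subset_union_right))]
    _ = ∑ q, volume.real (G q ∩ A) + ∑ j, volume.real (φ j '' convexHull ℝ F ∩ A) := by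
        rw [volumeReal_iUnion_image_inter hφ hTSC hC hA, measureReal_iUnion_fintype
          (fun q q' hne => (hG.pairwise_disjoint hne).mono inter_subset_left inter_subset_left)
          hmeas fun q => hfinite (inter_subset_inter_left _ (hG.subset_convexHull q))]

theorem sum_pow_lt_one (hG : IsOpenPartition φ F G) (hφ : ∀ j, IsSimilitude (φ j) (r j))
    (hF : IsAttractor φ F) (hTSC : TilesetCondition φ F) (hNTC : NontrivialityCondition φ F)
    (hC : IsCompact (convexHull ℝ F)) : ∑ j, r j ^ d < 1 := by
  have hvol := hG.volumeReal_convexHull_inter hφ hF hTSC hC MeasurableSet.univ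
  simp only [inter_univ, (hφ _).volumeReal_image, ← Finset.sum_mul] at hvol
  have := hG.nonempty_index hNTC
  have hpos : 0 < ∑ q, volume.real (G q) :=
    Finset.sum_pos (fun q _ => hG.volumeReal_pos hF.2.1.isBounded q) Finset.univ_nonempty
  by_contra! hge
  nlinarith [measureReal_nonneg (μ := volume) (s := convexHull ℝ F)]

theorem volumeReal_inter_cthickening_compl (hG : IsOpenPartition φ F G)
    (hφ : ∀ j, IsSimilitude (φ j) (r j)) (hC : IsClosed (convexHull ℝ F)) (q : Fin Q) (ε : ℝ) :
    volume.real (G q ∩ Metric.cthickening ε (G q)ᶜ) = innerTubeVolume (G q) ε := by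
  have hclosure : (G q : Set (Euc d)) =ᵐ[volume] closure (G q) := by
    refine subset_closure.eventuallyLE.antisymm (ae_le_set.2 ?_)
    rw [← (hG.isOpen q).frontier_eq]
    exact hG.volume_frontier hφ hC q
  exact measureReal_congr (hclosure.inter (ae_eq_refl _))

theorem volumeReal_inter_cthickening (hG : IsOpenPartition φ F G)
    (hφ : ∀ j, IsSimilitude (φ j) (r j)) (hF : IsAttractor φ F) (hPWC : PearseWinterCondition F)
    (q : Fin Q) (ε : ℝ) :
    volume.real (G q ∩ Metric.cthickening ε F) = innerTubeVolume (G q) ε := by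
  have hC := (hPWC.isCompact_convexHull hF.2.1.isBounded).isClosed
  have hfrontier : frontier (G q) ⊆ F := (hG.frontier_subset hC q).trans <|
    iUnion_subset fun j => (hPWC.frontier_image_subset hφ j).trans (hF.image_subset j)
  rw [← inter_cthickening_eq_of_frontier_subset hfrontier (hG.subset_compl hF q)
    (fun y hy => Or.inr fun hyi => hy (interior_subset hyi)) ε]
  exact hG.volumeReal_inter_cthickening_compl hφ hC q ε

end IsOpenPartition

/-! ### The tube inside the convex hull -/

/-- The volume of the part of the `ε`-neighbourhood of `A` inside the convex hull of `A`. -/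
noncomputable def hullTube (A : Set (Euc d)) (ε : ℝ) : ℝ :=
  volume.real (convexHull ℝ A ∩ Metric.cthickening ε A)

theorem image_inter_cthickening (hφ : ∀ j, IsSimilitude (φ j) (r j)) (hF : IsAttractor φ F)
    (hTSC : TilesetCondition φ F) (hPWC : PearseWinterCondition F) (j : Fin J) (ε : ℝ) :
    φ j '' convexHull ℝ F ∩ Metric.cthickening ε F =
      φ j '' (convexHull ℝ F ∩ Metric.cthickening (ε / r j) F) := by
  have hcover : ∀ y ∈ F, y ∈ φ j '' F ∨ y ∉ interior (φ j '' convexHull ℝ F) := by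
    intro y hy
    obtain ⟨k, hk⟩ := hF.exists_mem_image hy
    rcases eq_or_ne j k with rfl | hjk
    · exact Or.inl hk
    · exact Or.inr (disjoint_left.1 (hTSC.disjoint_interior_image hφ hjk)
        (image_mono (subset_convexHull ℝ F) hk))
  rw [inter_cthickening_eq_of_frontier_subset (hPWC.frontier_image_subset hφ j)
    (hF.image_subset j) hcover, image_inter (hφ j).injective, (hφ j).image_cthickening,
    ← inter_assoc, inter_eq_left.2 (image_subset_range _ _)]

theorem IsOpenPartition.hullTube_eq (hG : IsOpenPartition φ F G)
    (hφ : ∀ j, IsSimilitude (φ j) (r j)) (hF : IsAttractor φ F) (hTSC : TilesetCondition φ F)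
    (hPWC : PearseWinterCondition F) (ε : ℝ) :
    hullTube F ε = ∑ q, innerTubeVolume (G q) ε + ∑ j, r j ^ d * hullTube F (ε / r j) := by
  rw [hullTube, hG.volumeReal_convexHull_inter hφ hF hTSC
    (hPWC.isCompact_convexHull hF.2.1.isBounded) Metric.isClosed_cthickening.measurableSet]
  simp only [hG.volumeReal_inter_cthickening hφ hF hPWC, image_inter_cthickening hφ hF hTSC hPWC,
    (hφ _).volumeReal_image, hullTube]

section Bounded

variable {A : Set (Euc d)}

theorem volume_convexHull_inter_ne_top (hA : Bornology.IsBounded A) (B : Set (Euc d)) :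
    volume (convexHull ℝ A ∩ B) ≠ ⊤ :=
  ((isBounded_convexHull.2 hA).subset inter_subset_left).measure_lt_top.ne

theorem hullTube_mono (hA : Bornology.IsBounded A) : Monotone (hullTube A) := fun _ _ h =>
  measureReal_mono (inter_subset_inter_right _ (Metric.cthickening_mono h A))
    (volume_convexHull_inter_ne_top hA _)

theorem hullTube_le_volumeReal_convexHull (hA : Bornology.IsBounded A) (ε : ℝ) :
    hullTube A ε ≤ volume.real (convexHull ℝ A) :=
  measureReal_mono inter_subset_left (isBounded_convexHull.2 hA).measure_lt_top.ne

theorem hullTube_pos (hA : Bornology.IsBounded A) (hint : (interior (convexHull ℝ A)).Nonempty)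
    {ε : ℝ} (hε : 0 < ε) : 0 < hullTube A ε := by
  obtain ⟨x, hx⟩ := convexHull_nonempty_iff.1 (hint.mono interior_subset)
  have hxc : x ∈ closure (interior (convexHull ℝ A)) := by
    rw [(convex_convexHull ℝ A).closure_interior_eq_closure_of_nonempty_interior hint]
    exact subset_closure (subset_convexHull ℝ A hx)
  have hne := mem_closure_iff.1 hxc _ Metric.isOpen_ball (Metric.mem_ball_self hε)
  refine ENNReal.toReal_pos (ne_of_gt ?_) (volume_convexHull_inter_ne_top hA _)
  refine ((Metric.isOpen_ball.inter isOpen_interior).measure_pos volume hne).trans_le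
    (measure_mono fun z hz => ⟨interior_subset hz.2, ?_⟩)
  exact Metric.mem_cthickening_of_dist_le z x ε A hx (Metric.mem_ball.1 hz.1).le

theorem tubeVolume_mono (hA : Bornology.IsBounded A) : Monotone (tubeVolume A) := fun _ _ h =>
  measureReal_mono (Metric.cthickening_mono h A) hA.cthickening.measure_lt_top.ne

theorem hullTube_le_tubeVolume (hA : Bornology.IsBounded A) (ε : ℝ) :
    hullTube A ε ≤ tubeVolume A ε :=
  measureReal_mono inter_subset_right hA.cthickening.measure_lt_top.ne

theorem exists_tubeVolume_le (hC : IsCompact (convexHull ℝ A))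
    (hint : (interior (convexHull ℝ A)).Nonempty) :
    ∃ K : ℝ, ∀ ε, 0 ≤ ε → ε ≤ 1 → tubeVolume A ε ≤ hullTube A ε + K * ε := by
  obtain ⟨K, hK⟩ := exists_measureReal_cthickening_le volume (convex_convexHull ℝ A) hC hint
  refine ⟨K, fun ε h0 h1 => ?_⟩
  have hsub : Metric.cthickening ε A \ convexHull ℝ A ⊆
      Metric.cthickening ε (convexHull ℝ A) \ convexHull ℝ A :=
    sdiff_subset_sdiff_left (Metric.cthickening_subset_of_subset _ (subset_convexHull ℝ A))
  have hfinite : volume (Metric.cthickening ε (convexHull ℝ A)) ≠ ⊤ :=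
    hC.cthickening.measure_lt_top.ne
  calc tubeVolume A ε
      = hullTube A ε + volume.real (Metric.cthickening ε A \ convexHull ℝ A) := by
        rw [tubeVolume, hullTube, inter_comm, measureReal_inter_add_sdiff hC.measurableSet
          (measure_ne_top_of_subset (Metric.cthickening_subset_of_subset _
            (subset_convexHull ℝ A)) hfinite)]
    _ ≤ hullTube A ε + volume.real (Metric.cthickening ε (convexHull ℝ A) \ convexHull ℝ A) := by
        gcongr
        exact measure_ne_top_of_subset sdiff_subset hfinite
    _ ≤ hullTube A ε + K * ε := by
        rw [measureReal_sdiff (Metric.self_subset_cthickening _) hC.measurableSet hfinite]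
        linarith [hK ε h0 h1]

end Bounded

end Hull

/-! ### Inradius and inner tubes -/

section Inradius

variable {d : ℕ} {G : Set (Euc d)}

theorem bddAbove_radii [Nonempty (Fin d)] (hG : Bornology.IsBounded G) :
    BddAbove {ρ : ℝ | 0 < ρ ∧ ∃ x, Metric.ball x ρ ⊆ G} := by
  refine ⟨2 * Metric.diam G, ?_⟩
  rintro ρ ⟨hρ, x, hx⟩
  obtain ⟨v, hv⟩ := exists_norm_eq (Euc d) (half_pos hρ).le
  have hdist := Metric.dist_le_diam_of_mem hG (x := x + v) (y := x)
    (hx (by simp [hv, hρ])) (hx (Metric.mem_ball_self hρ))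
  rw [dist_self_add_left, hv] at hdist
  linarith

theorem inradius_pos [Nonempty (Fin d)] (hG : Bornology.IsBounded G) (hopen : IsOpen G)
    (hne : G.Nonempty) : 0 < inradius G := by
  obtain ⟨x, hx⟩ := hne
  obtain ⟨ρ, hρ, hball⟩ := Metric.isOpen_iff.1 hopen x hx
  exact hρ.trans_le (le_csSup (bddAbove_radii hG) ⟨hρ, x, hball⟩)

theorem infDist_compl_le_inradius [Nonempty (Fin d)] (hG : Bornology.IsBounded G) (x : Euc d) :
    Metric.infDist x Gᶜ ≤ inradius G := by
  rcases (Metric.infDist_nonneg (x := x) (s := Gᶜ)).eq_or_lt with h0 | h0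
  · rw [← h0]
    exact Real.sSup_nonneg fun ρ hρ => hρ.1.le
  · exact le_csSup (bddAbove_radii hG) ⟨h0, x, Metric.ball_infDist_compl_subset⟩

theorem inter_cthickening_compl_eq_self [Nonempty (Fin d)] (hG : Bornology.IsBounded G) {ε : ℝ}
    (hε : inradius G ≤ ε) : G ∩ Metric.cthickening ε Gᶜ = G := by
  have hne : (Gᶜ).Nonempty := by
    rw [nonempty_compl]
    rintro rfl
    exact NormedSpace.unbounded_univ ℝ (Euc d) hG
  refine inter_eq_left.2 fun x _ => ?_
  rw [Metric.mem_cthickening_iff, ← ENNReal.ofReal_toReal (Metric.infEDist_ne_top hne)]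
  exact ENNReal.ofReal_le_ofReal ((infDist_compl_le_inradius hG x).trans hε)

theorem innerTubeVolume_nonneg (ε : ℝ) : 0 ≤ innerTubeVolume G ε := measureReal_nonneg

end Inradius

/-! ### The renewal equation -/

section Renewal

variable {ι : Type*} {p a : ι → ℝ} {Z z : ℝ → ℝ} {A I : ℝ}

theorem tendsto_sub_const_atTop (x : ℝ) : Tendsto (fun t : ℝ => t - x) atTop atTop :=
  tendsto_atTop_add_const_right atTop (-x) tendsto_id

theorem exists_forall_lt_of_pos [Finite ι] (ha : ∀ j, 0 < a j) : ∃ x, 0 < x ∧ ∀ j, x < a j :=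
  ((eventually_mem_nhdsWithin (a := (0 : ℝ)) (s := Ioi 0)).and
    (eventually_all.2 fun j => nhdsWithin_le_nhds (eventually_lt_nhds (ha j)))).exists

theorem forall_of_forall_sub [Finite ι] (ha : ∀ j, 0 < a j) {P : ℝ → Prop} {T : ℝ}
    (base : ∀ t ≤ T, P t) (step : ∀ t, T < t → (∀ j, P (t - a j)) → P t) (t : ℝ) : P t := by
  obtain ⟨x, hx, hxa⟩ := exists_forall_lt_of_pos ha
  have key (n : ℕ) : ∀ t ≤ T + n * x, P t := by
    induction n with
    | zero => simpa using base
    | succ n ih =>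
      intro t ht
      rcases le_or_gt t T with h | h
      · exact base t h
      · refine step t h fun j => ih _ ?_
        push_cast at ht
        linarith [hxa j]
  obtain ⟨n, hn⟩ := exists_nat_ge ((t - T) / x)
  exact key n t (by linarith [(div_le_iff₀ hx).1 hn])

variable [Fintype ι]

/-- `Z` solves the renewal equation with source `z`, weights `p` and steps `a`. -/
def IsRenewal (p a : ι → ℝ) (z Z : ℝ → ℝ) : Prop :=
  ∀ t, Z t = z t + ∑ j, p j * Z (t - a j)

/-- The weighted mass of `Z` in the windows `[t - a j, t]`. When the weights have sum `1`, the
renewal equation says that its derivative is the source. -/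
noncomputable def renewalMass (p a : ι → ℝ) (Z : ℝ → ℝ) (t : ℝ) : ℝ :=
  ∑ j, p j * ∫ u in (t - a j)..t, Z u

theorem sum_mul_pos_of_sum_eq_one (hp : ∀ j, 0 < p j) (hp1 : ∑ j, p j = 1)
    (ha : ∀ j, 0 < a j) : 0 < ∑ j, p j * a j :=
  Finset.sum_pos (fun j _ => mul_pos (hp j) (ha j))
    (Finset.nonempty_of_sum_ne_zero (hp1.trans_ne one_ne_zero))

namespace IsRenewal

theorem neg (h : IsRenewal p a z Z) : IsRenewal p a (-z) (-Z) := fun t => by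
  simp only [Pi.neg_apply, h t, mul_neg, Finset.sum_neg_distrib, neg_add]

theorem source_eq (h : IsRenewal p a z Z) (t : ℝ) : z t = Z t - ∑ j, p j * Z (t - a j) :=
  eq_sub_of_add_eq (h t).symm

theorem le_of_sum_lt_one (h : IsRenewal p a z Z) (hp : ∀ j, 0 < p j) (hp1 : ∑ j, p j < 1)
    (ha : ∀ j, 0 < a j) {T V B : ℝ} (hZ : ∀ t ≤ T, Z t ≤ V) (hz : ∀ t, T < t → z t ≤ B) (t : ℝ) :
    Z t ≤ max V (B / (1 - ∑ j, p j)) := by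
  set K := max V (B / (1 - ∑ j, p j))
  have hBK : B + (∑ j, p j) * K ≤ K := by
    have : B / (1 - ∑ j, p j) ≤ K := le_max_right _ _
    rw [div_le_iff₀ (by linarith)] at this
    linarith
  refine forall_of_forall_sub ha (fun t ht => (hZ t ht).trans (le_max_left _ _))
    (fun t ht ih => ?_) t
  calc Z t ≤ B + ∑ j, p j * K := by
        rw [h t]
        gcongr with j _
        · exact hz t ht
        · exact (hp j).le
        · exact ih j
    _ ≤ K := by rwa [← Finset.sum_mul]

theorem le_of_sum_eq_one (h : IsRenewal p a z Z) (hp : ∀ j, 0 < p j) (hp1 : ∑ j, p j = 1)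
    (ha : ∀ j, 0 < a j) (haA : ∀ j, a j ≤ A) {T c : ℝ} (hZ : ∀ t ∈ Icc (T - A) T, c ≤ Z t)
    (hz : ∀ t, T < t → 0 ≤ z t) {t : ℝ} (ht : T - A ≤ t) : c ≤ Z t := by
  refine forall_of_forall_sub (P := fun t => T - A ≤ t → c ≤ Z t) ha
    (fun t htT ht => hZ t ⟨ht, htT⟩) (fun t htT ih _ => ?_) t ht
  calc c = 0 + ∑ j, p j * c := by rw [← Finset.sum_mul, hp1, one_mul, zero_add]
    _ ≤ Z t := by
        rw [h t]
        gcongr with j _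
        · exact hz t htT
        · exact (hp j).le
        · exact ih j (by linarith [haA j])

/-! ### The window mass -/

theorem renewalMass_sub (h : IsRenewal p a z Z) (hp1 : ∑ j, p j = 1)
    (hint : ∀ s t, IntervalIntegrable Z volume s t) (s t : ℝ) :
    renewalMass p a Z t - renewalMass p a Z s = ∫ u in s..t, z u := by
  have hshift (j : ι) : IntervalIntegrable (fun u => p j * Z (u - a j)) volume s t := by
    simpa using ((hint (s - a j) (t - a j)).comp_sub_right (a j)).const_mul (p j)
  have hsum : IntervalIntegrable (fun u => ∑ j, p j * Z (u - a j)) volume s t := by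
    simpa only [Finset.sum_fn] using IntervalIntegrable.sum Finset.univ fun j _ => hshift j
  have hwindow (j : ι) : (∫ u in (t - a j)..t, Z u) - ∫ u in (s - a j)..s, Z u
      = (∫ u in s..t, Z u) - ∫ u in (s - a j)..(t - a j), Z u := by
    rw [← intervalIntegral.integral_interval_sub_interval_comm' (hint _ _) (hint _ _) (hint _ _)]
  calc renewalMass p a Z t - renewalMass p a Z s
      = (∑ j, p j) * (∫ u in s..t, Z u) - ∑ j, p j * ∫ u in (s - a j)..(t - a j), Z u := by
        simp only [renewalMass, ← Finset.sum_sub_distrib, ← mul_sub, hwindow, Finset.sum_mul]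
    _ = ∫ u in s..t, (Z u - ∑ j, p j * Z (u - a j)) := by
        rw [hp1, one_mul, intervalIntegral.integral_sub (hint s t) hsum,
          intervalIntegral.integral_finsetSum fun j _ => hshift j]
        simp only [intervalIntegral.integral_const_mul, intervalIntegral.integral_comp_sub_right]
    _ = ∫ u in s..t, z u := by simp only [← h.source_eq]

end IsRenewal

theorem tendsto_renewalMass_atBot (hbot : Tendsto Z atBot (𝓝 0)) :
    Tendsto (renewalMass p a Z) atBot (𝓝 0) := by
  rw [show (0 : ℝ) = ∑ j, p j * 0 by simp]
  refine tendsto_finsetSum _ fun j _ => Tendsto.const_mul _ ?_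
  rw [Metric.tendsto_nhds]
  intro e he
  have hpos : 0 < |a j| + 1 := by positivity
  obtain ⟨T, hT⟩ := eventually_atBot.1 (Metric.tendsto_nhds.1 hbot _ (div_pos he hpos))
  filter_upwards [eventually_le_atBot (T - |a j|)] with s hs
  rw [dist_zero_right]
  calc ‖∫ u in (s - a j)..s, Z u‖ ≤ e / (|a j| + 1) * |s - (s - a j)| := by
        refine intervalIntegral.norm_integral_le_of_norm_le_const fun u hu => ?_
        have hmax : u ≤ max (s - a j) s := hu.2
        have huT : u ≤ T := hmax.trans
          (max_le (by linarith [neg_abs_le (a j)]) (by linarith [abs_nonneg (a j)]))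
        simpa using (hT u huT).le
    _ < e := by
        rw [sub_sub_cancel, div_mul_eq_mul_div, div_lt_iff₀ hpos]
        nlinarith

theorem IsRenewal.tendsto_renewalMass (h : IsRenewal p a z Z) (hp1 : ∑ j, p j = 1)
    (hint : ∀ s t, IntervalIntegrable Z volume s t) (hz : Integrable z)
    (hbot : Tendsto Z atBot (𝓝 0)) :
    Tendsto (renewalMass p a Z) atTop (𝓝 (∫ t, z t)) := by
  have hlim := intervalIntegral_tendsto_integral (μ := volume) hz tendsto_neg_atTop_atBot tendsto_id
  simp only [id, ← h.renewalMass_sub hp1 hint] at hlim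
  simpa using hlim.add
    ((tendsto_renewalMass_atBot (p := p) (a := a) hbot).comp tendsto_neg_atTop_atBot)

theorem renewalMass_neg (p a : ι → ℝ) (Z : ℝ → ℝ) :
    renewalMass p a (-Z) = -renewalMass p a Z := by
  ext t
  simp only [renewalMass, Pi.neg_apply, intervalIntegral.integral_neg, mul_neg,
    Finset.sum_neg_distrib]

theorem le_renewalMass (hp : ∀ j, 0 < p j) (ha : ∀ j, 0 < a j) (haA : ∀ j, a j ≤ A)
    (hint : ∀ s t, IntervalIntegrable Z volume s t) {c t : ℝ}
    (hc : ∀ u ∈ Icc (t - A) t, c ≤ Z u) : (∑ j, p j * a j) * c ≤ renewalMass p a Z t := by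
  rw [renewalMass, Finset.sum_mul]
  refine Finset.sum_le_sum fun j _ => ?_
  rw [mul_assoc]
  refine mul_le_mul_of_nonneg_left ?_ (hp j).le
  calc a j * c = ∫ _ in (t - a j)..t, c := by simp
    _ ≤ ∫ u in (t - a j)..t, Z u :=
      intervalIntegral.integral_mono_on (by linarith [ha j]) (by simp) (hint _ _)
        fun u hu => hc u ⟨by linarith [hu.1, haA j], hu.2⟩

theorem bddAbove_of_tendsto_renewalMass (hp : ∀ j, 0 < p j) (hp1 : ∑ j, p j = 1)
    (ha : ∀ j, 0 < a j) (hint : ∀ s t, IntervalIntegrable Z volume s t)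
    (hW : Tendsto (renewalMass p a Z) atTop (𝓝 I)) (hZ : ∀ t, 0 ≤ Z t) {α : ℝ} (hα : 0 ≤ α)
    (hgrow : ∀ s t, s ≤ t → Z t ≤ Real.exp (α * (t - s)) * Z s)
    (hleft : ∀ T, BddAbove (Z '' Iic T)) : BddAbove (range Z) := by
  have hμ := sum_mul_pos_of_sum_eq_one hp hp1 ha
  obtain ⟨A, hA⟩ := Finite.exists_le a
  obtain ⟨T, hT⟩ := eventually_atTop.1 (hW.eventually_le_const (lt_add_one I))
  obtain ⟨V, hV⟩ := hleft T
  refine ⟨max V (Real.exp (α * A) * ((I + 1) / ∑ j, p j * a j)), forall_mem_range.2 fun t => ?_⟩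
  rcases le_total t T with ht | ht
  · exact (hV (mem_image_of_mem Z ht)).trans (le_max_left _ _)
  have hwindow : ∀ u ∈ Icc (t - A) t, Real.exp (-(α * A)) * Z t ≤ Z u := fun u hu => by
    rw [Real.exp_neg, inv_mul_le_iff₀ (Real.exp_pos _)]
    refine (hgrow u t hu.2).trans (mul_le_mul_of_nonneg_right ?_ (hZ u))
    exact Real.exp_le_exp.2 (mul_le_mul_of_nonneg_left (by linarith [hu.1]) hα)
  have hmass := (le_renewalMass hp ha hA hint hwindow).trans (hT t ht)
  rw [mul_comm, ← le_div_iff₀ hμ, Real.exp_neg, inv_mul_le_iff₀ (Real.exp_pos _)] at hmass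
  exact hmass.trans (le_max_right _ _)

/-! ### Averages of solutions -/

namespace IsRenewal

theorem abs_le_of_sum_eq_one (h : IsRenewal p a z Z) (hp : ∀ j, 0 < p j) (hp1 : ∑ j, p j = 1)
    (ha : ∀ j, 0 < a j) (haA : ∀ j, a j ≤ A) {T K e : ℝ} (he : 0 ≤ e)
    (hz : ∀ t, T ≤ t → |z t| ≤ e * ∑ j, p j * a j) (hZ : ∀ t ∈ Icc T (T + A), |Z t| ≤ K) {t : ℝ}
    (ht : T ≤ t) : |Z t| ≤ e * (t - T) + K := by
  refine forall_of_forall_sub (P := fun t => T ≤ t → |Z t| ≤ e * (t - T) + K) ha (T := T + A)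
    (fun t ht hTt => ?_) (fun t ht ih hTt => ?_) t ht
  · nlinarith [hZ t ⟨hTt, ht⟩, mul_nonneg he (sub_nonneg.2 hTt)]
  · calc |Z t| ≤ |z t| + ∑ j, |p j * Z (t - a j)| := by
          rw [h t]
          exact (abs_add_le _ _).trans (by gcongr; exact Finset.abs_sum_le_sum_abs _ _)
      _ ≤ e * (∑ j, p j * a j) + ∑ j, p j * (e * (t - a j - T) + K) := by
          gcongr with j
          · exact hz t hTt
          · rw [abs_mul, abs_of_pos (hp j)]
            exact mul_le_mul_of_nonneg_left (ih j (by linarith [haA j])) (hp j).le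
      _ = (∑ j, p j) * (e * (t - T) + K) := by
          rw [Finset.mul_sum, Finset.sum_mul, ← Finset.sum_add_distrib]
          exact Finset.sum_congr rfl fun j _ => by ring
      _ = e * (t - T) + K := by rw [hp1, one_mul]

theorem tendsto_div_atTop (h : IsRenewal p a z Z) (hp : ∀ j, 0 < p j) (hp1 : ∑ j, p j = 1)
    (ha : ∀ j, 0 < a j) (hZ : Continuous Z) (hz : Tendsto z atTop (𝓝 0)) :
    Tendsto (fun t => Z t / t) atTop (𝓝 0) := by
  have hμ := sum_mul_pos_of_sum_eq_one hp hp1 ha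
  obtain ⟨A, hA⟩ := Finite.exists_le a
  rw [Metric.tendsto_nhds]
  intro e he
  obtain ⟨T, hT⟩ := eventually_atTop.1
    (Metric.tendsto_nhds.1 hz (e / 2 * ∑ j, p j * a j) (by positivity))
  obtain ⟨K, hK⟩ := (isCompact_Icc (a := T) (b := T + A)).exists_bound_of_continuousOn
    hZ.continuousOn
  filter_upwards [eventually_gt_atTop 0, eventually_ge_atTop T,
    eventually_gt_atTop ((K - e / 2 * T) / (e / 2))] with t ht0 htT htK
  have hbound := h.abs_le_of_sum_eq_one hp hp1 ha hA (half_pos he).le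
    (fun s hs => by simpa using (hT s hs).le) hK htT
  rw [div_lt_iff₀ (by positivity)] at htK
  rw [dist_zero_right, Real.norm_eq_abs, abs_div, abs_of_pos ht0, div_lt_iff₀ ht0]
  linarith

end IsRenewal

theorem isRenewal_primitive_sub (hp1 : ∑ j, p j = 1)
    (hint : ∀ s t, IntervalIntegrable Z volume s t) (c : ℝ) :
    IsRenewal p a (fun t => renewalMass p a Z t - c * ∑ j, p j * a j)
      fun t => (∫ u in (0 : ℝ)..t, Z u) - c * t := fun t => by
  have hwindow (j : ι) : ∫ u in (t - a j)..t, Z u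
      = (∫ u in (0 : ℝ)..t, Z u) - ∫ u in (0 : ℝ)..(t - a j), Z u :=
    (intervalIntegral.integral_interval_sub_left (hint _ _) (hint _ _)).symm
  simp only [renewalMass, hwindow]
  calc (∫ u in (0 : ℝ)..t, Z u) - c * t
      = (∑ j, p j) * ((∫ u in (0 : ℝ)..t, Z u) - c * t) := by rw [hp1, one_mul]
    _ = _ := by
      rw [Finset.sum_mul, Finset.mul_sum, ← Finset.sum_sub_distrib, ← Finset.sum_add_distrib]
      exact Finset.sum_congr rfl fun j _ => by ring

theorem tendsto_average_of_tendsto_renewalMass (hp : ∀ j, 0 < p j) (hp1 : ∑ j, p j = 1)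
    (ha : ∀ j, 0 < a j) (hint : ∀ s t, IntervalIntegrable Z volume s t)
    (hW : Tendsto (renewalMass p a Z) atTop (𝓝 I)) :
    Tendsto (fun T : ℝ => (∫ t in (0 : ℝ)..T, Z t) / T) atTop (𝓝 (I / ∑ j, p j * a j)) := by
  have hμ := sum_mul_pos_of_sum_eq_one hp hp1 ha
  set c := I / ∑ j, p j * a j
  have hcμ : c * ∑ j, p j * a j = I := div_mul_cancel₀ _ hμ.ne'
  have hcont : Continuous fun t => (∫ u in (0 : ℝ)..t, Z u) - c * t :=
    (intervalIntegral.continuous_primitive hint 0).sub (continuous_const.mul continuous_id)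
  have hlim := (isRenewal_primitive_sub hp1 hint c).tendsto_div_atTop hp hp1 ha hcont
    (by simpa [hcμ] using hW.sub_const I)
  have := hlim.add_const c
  rw [zero_add] at this
  refine this.congr' ?_
  filter_upwards [eventually_ne_atTop 0] with t ht
  field_simp
  ring

/-! ### Convergence of solutions for steps generating a dense group -/

/-- `Z` is slowly increasing: it increases by at most `e` over intervals of a length depending
only on `e`. -/
def IsSlowlyIncreasing (Z : ℝ → ℝ) : Prop :=
  ∀ e > 0, ∃ δ > 0, ∀ u, ∀ x ∈ Icc u (u + δ), Z x ≤ Z u + e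

theorem isSlowlyIncreasing_of_le_exp_mul {α : ℝ} (hα : 0 ≤ α) (hZ : ∀ t, 0 ≤ Z t)
    (hbdd : BddAbove (range Z)) (hgrow : ∀ s t, s ≤ t → Z t ≤ Real.exp (α * (t - s)) * Z s) :
    IsSlowlyIncreasing Z := by
  intro e he
  obtain ⟨B, hB⟩ := hbdd
  have hlim : Tendsto (fun δ : ℝ => (Real.exp (α * δ) - 1) * B) (𝓝[>] 0) (𝓝 0) := by
    have : Continuous fun δ : ℝ => (Real.exp (α * δ) - 1) * B := by fun_prop
    simpa using (this.tendsto 0).mono_left nhdsWithin_le_nhds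
  obtain ⟨δ, hδ, hδe⟩ :=
    (eventually_mem_nhdsWithin.and (hlim.eventually_le_const he)).exists
  refine ⟨δ, hδ, fun u x hx => ?_⟩
  have hexp : Real.exp (α * (x - u)) ≤ Real.exp (α * δ) :=
    Real.exp_le_exp.2 (mul_le_mul_of_nonneg_left (by linarith [hx.2]) hα)
  have hone : 1 ≤ Real.exp (α * δ) := Real.one_le_exp (mul_nonneg hα (le_of_lt hδ))
  nlinarith [hgrow u x hx.1, mul_le_mul_of_nonneg_right hexp (hZ u),
    mul_le_mul_of_nonneg_left (hB (mem_range_self u)) (sub_nonneg.2 hone)]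

namespace IsRenewal

theorem tendsto_comp_sub_step (h : IsRenewal p a z Z) (hp : ∀ j, 0 < p j) (hp1 : ∑ j, p j = 1)
    (hz : Tendsto z atTop (𝓝 0)) (hbdd : IsBoundedUnder (· ≤ ·) atTop Z) {l : Filter ℝ}
    (hl : l ≤ atTop) (hZ : Tendsto Z l (𝓝 (limsup Z atTop))) (j : ι) :
    Tendsto (fun t => Z (t - a j)) l (𝓝 (limsup Z atTop)) := by
  have hup (k : ι) {e : ℝ} (he : limsup Z atTop < e) : ∀ᶠ t in l, Z (t - a k) < e :=
    ((tendsto_sub_const_atTop (a k)).mono_left hl).eventually (eventually_lt_of_limsup_lt he hbdd)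
  refine tendsto_order.2 ⟨fun b hb => ?_, fun b hb => hup j hb⟩
  set S := limsup Z atTop
  set e := p j * (S - b) / 4 with he
  have he0 : 0 < e := by have := hp j; have := sub_pos.2 hb; positivity
  filter_upwards [eventually_all.2 fun k => hup k (show S < S + e by linarith),
    hZ.eventually_const_lt (show S - e < S by linarith),
    (hz.mono_left hl).eventually_lt_const he0] with t hk hSt hzt
  have hgap : p j * (S + e - Z (t - a j)) ≤ S + e - (Z t - z t) :=
    calc p j * (S + e - Z (t - a j)) ≤ ∑ k, p k * (S + e - Z (t - a k)) :=
          Finset.single_le_sum (f := fun k => p k * (S + e - Z (t - a k)))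
            (fun k _ => mul_nonneg (hp k).le (sub_nonneg.2 (hk k).le)) (Finset.mem_univ j)
      _ = S + e - (Z t - z t) := by
          simp only [mul_sub, Finset.sum_sub_distrib, ← Finset.sum_mul, hp1, one_mul]
          linarith [h t]
  refine lt_of_mul_lt_mul_left ?_ (hp j).le
  nlinarith [mul_pos (hp j) he0, show p j * (S - b) = 4 * e by rw [he]; ring]

theorem tendsto_comp_sub (h : IsRenewal p a z Z) (hp : ∀ j, 0 < p j) (hp1 : ∑ j, p j = 1)
    (hz : Tendsto z atTop (𝓝 0)) (hbdd : IsBoundedUnder (· ≤ ·) atTop Z) {s : ℝ}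
    (hs : s ∈ AddSubmonoid.closure (range a)) {l : Filter ℝ} (hl : l ≤ atTop)
    (hZ : Tendsto Z l (𝓝 (limsup Z atTop))) :
    Tendsto (fun t => Z (t - s)) l (𝓝 (limsup Z atTop)) := by
  induction hs using AddSubmonoid.closure_induction generalizing l with
  | mem x hx =>
    obtain ⟨j, rfl⟩ := hx
    exact h.tendsto_comp_sub_step hp hp1 hz hbdd hl hZ j
  | zero => simpa using hZ
  | add x y _ _ ihx ihy =>
    have hxl : Tendsto (fun t => t - x) l atTop := (tendsto_sub_const_atTop x).mono_left hl
    have hxy := ihy hxl (tendsto_map'_iff.2 (ihx hl hZ))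
    simpa only [tendsto_map'_iff, Function.comp_def, sub_sub] using hxy

end IsRenewal

theorem exists_sub_of_mem_closure {M : Type*} [AddCommGroup M] {S : Set M} {x : M}
    (hx : x ∈ AddSubgroup.closure S) :
    ∃ s ∈ AddSubmonoid.closure S, ∃ t ∈ AddSubmonoid.closure S, x = s - t := by
  induction hx using AddSubgroup.closure_induction with
  | mem x hx => exact ⟨x, AddSubmonoid.subset_closure hx, 0, zero_mem _, by simp⟩
  | zero => exact ⟨0, zero_mem _, 0, zero_mem _, by simp⟩
  | add x y _ _ hx hy =>
    obtain ⟨s, hs, t, ht, rfl⟩ := hx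
    obtain ⟨s', hs', t', ht', rfl⟩ := hy
    exact ⟨s + s', add_mem hs hs', t + t', add_mem ht ht', by abel⟩
  | neg x _ hx =>
    obtain ⟨s, hs, t, ht, rfl⟩ := hx
    exact ⟨t, ht, s, hs, by abel⟩

/- Given `s₁`, `s₂` in the semigroup with `0 < s₁ - s₂ < δ`, the semigroup contains the arithmetic
progression `k s₁ + (n - k) s₂`, `0 ≤ k ≤ n`, of step `s₁ - s₂`. -/
theorem exists_finset_forall_mem_Icc {S : Set ℝ}
    (hd : Dense (AddSubgroup.closure S : Set ℝ)) {δ : ℝ} (hδ : 0 < δ) (A : ℝ) :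
    ∃ (T : ℝ) (N : Finset ℝ), (∀ s ∈ N, s ∈ AddSubmonoid.closure S) ∧
      ∀ u ∈ Icc T (T + A), ∃ s ∈ N, s ≤ u ∧ u ≤ s + δ := by
  obtain ⟨x, hx, hx0, hxδ⟩ := hd.exists_between hδ
  obtain ⟨s₁, hs₁, s₂, hs₂, rfl⟩ := exists_sub_of_mem_closure hx
  obtain ⟨n, hn⟩ := exists_nat_ge (A / (s₁ - s₂))
  refine ⟨n * s₂, (Finset.range (n + 1)).image fun k : ℕ => n * s₂ + k * (s₁ - s₂),
    Finset.forall_mem_image.2 fun k hk => ?_, fun u hu => ?_⟩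
  · have hkn := Nat.lt_succ_iff.1 (Finset.mem_range.1 hk)
    rw [show n * s₂ + k * (s₁ - s₂) = k • s₁ + (n - k) • s₂ by
      rw [nsmul_eq_mul, nsmul_eq_mul, Nat.cast_sub hkn]
      ring]
    exact add_mem (nsmul_mem hs₁ _) (nsmul_mem hs₂ _)
  · have hnonneg : 0 ≤ (u - n * s₂) / (s₁ - s₂) := div_nonneg (by linarith [hu.1]) hx0.le
    have hle := Nat.floor_le hnonneg
    have hlt := Nat.lt_floor_add_one ((u - n * s₂) / (s₁ - s₂))
    set k := ⌊(u - n * s₂) / (s₁ - s₂)⌋₊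
    have hkn : k ≤ n := by
      have : (u - n * s₂) / (s₁ - s₂) ≤ A / (s₁ - s₂) := by
        gcongr
        linarith [hu.2]
      exact_mod_cast hle.trans (this.trans hn)
    rw [le_div_iff₀ hx0] at hle
    rw [div_lt_iff₀ hx0] at hlt
    exact ⟨_, Finset.mem_image_of_mem _ (Finset.mem_range.2 (Nat.lt_succ_of_le hkn)),
      by linarith, by linarith⟩

namespace IsRenewal

theorem frequently_limsup_sub_lt (h : IsRenewal p a z Z) (hp : ∀ j, 0 < p j)
    (hp1 : ∑ j, p j = 1) (hz : Tendsto z atTop (𝓝 0)) (hle : IsBoundedUnder (· ≤ ·) atTop Z)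
    (hge : IsBoundedUnder (· ≥ ·) atTop Z)
    (hdense : Dense (AddSubgroup.closure (range a) : Set ℝ)) (A : ℝ) {δ : ℝ} (hδ : 0 < δ) :
    ∃ᶠ t in atTop, ∀ u ∈ Icc (t - A) t, ∃ x ∈ Icc u (u + δ), limsup Z atTop - δ < Z x := by
  obtain ⟨U, hU, hZU⟩ := mapClusterPt_iff_ultrafilter.1
    (isGreatest_mapClusterPt_limsup hge.isCoboundedUnder_le hle).1
  obtain ⟨T, N, hN, hnet⟩ := exists_finset_forall_mem_Icc hdense hδ A
  have hev : ∀ᶠ t in (U : Filter ℝ), ∀ s ∈ N, limsup Z atTop - δ < Z (t - s) :=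
    (Finset.eventually_all N).2 fun s hs =>
      (h.tendsto_comp_sub hp hp1 hz hle (hN s hs) hU hZU).eventually_const_lt (by linarith)
  refine (tendsto_sub_const_atTop T).frequently
    ((hev.mono fun t ht u hu => ?_).frequently.filter_mono hU)
  obtain ⟨s, hs, hsu, hus⟩ := hnet (t - u) ⟨by linarith [hu.2], by linarith [hu.1]⟩
  exact ⟨t - s, ⟨by linarith, by linarith⟩, ht s hs⟩

end IsRenewal

theorem sum_mul_le_of_frequently_le_window (hp : ∀ j, 0 < p j) (ha : ∀ j, 0 < a j)
    (haA : ∀ j, a j ≤ A) (hint : ∀ s t, IntervalIntegrable Z volume s t)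
    (hW : Tendsto (renewalMass p a Z) atTop (𝓝 I)) {S : ℝ}
    (hfreq : ∀ e > 0, ∃ᶠ t in atTop, ∀ u ∈ Icc (t - A) t, S - e ≤ Z u) :
    (∑ j, p j * a j) * S ≤ I := by
  have hlim : Tendsto (fun e : ℝ => (∑ j, p j * a j) * (S - e)) (𝓝[>] 0)
      (𝓝 ((∑ j, p j * a j) * S)) := by
    have : Continuous fun e : ℝ => (∑ j, p j * a j) * (S - e) := by fun_prop
    simpa using (this.tendsto 0).mono_left nhdsWithin_le_nhds
  refine le_of_tendsto hlim (eventually_mem_nhdsWithin.mono fun e he => ?_)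
  exact ge_of_tendsto_of_frequently hW
    ((hfreq e he).mono fun t ht => le_renewalMass hp ha haA hint ht)

namespace IsRenewal

theorem sum_mul_limsup_le (h : IsRenewal p a z Z) (hp : ∀ j, 0 < p j) (hp1 : ∑ j, p j = 1)
    (ha : ∀ j, 0 < a j) (hint : ∀ s t, IntervalIntegrable Z volume s t)
    (hz : Tendsto z atTop (𝓝 0)) (hW : Tendsto (renewalMass p a Z) atTop (𝓝 I))
    (hle : IsBoundedUnder (· ≤ ·) atTop Z) (hge : IsBoundedUnder (· ≥ ·) atTop Z)
    (hslow : IsSlowlyIncreasing Z)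
    (hdense : Dense (AddSubgroup.closure (range a) : Set ℝ)) :
    (∑ j, p j * a j) * limsup Z atTop ≤ I := by
  obtain ⟨A, hA⟩ := Finite.exists_le a
  refine sum_mul_le_of_frequently_le_window hp ha hA hint hW fun e he => ?_
  obtain ⟨δ, hδ, hδe⟩ := hslow (e / 2) (half_pos he)
  refine (h.frequently_limsup_sub_lt hp hp1 hz hle hge hdense A
    (lt_min hδ (half_pos he))).mono fun t ht u hu => ?_
  obtain ⟨x, hx, hlt⟩ := ht u hu
  linarith [hδe u x ⟨hx.1, hx.2.trans (by gcongr; exact min_le_left _ _)⟩,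
    min_le_right δ (e / 2)]

theorem le_neg_sum_mul_limsup_neg (h : IsRenewal p a z Z) (hp : ∀ j, 0 < p j)
    (hp1 : ∑ j, p j = 1) (ha : ∀ j, 0 < a j) (hint : ∀ s t, IntervalIntegrable Z volume s t)
    (hz : Tendsto z atTop (𝓝 0)) (hW : Tendsto (renewalMass p a Z) atTop (𝓝 I))
    (hle : IsBoundedUnder (· ≤ ·) atTop Z) (hge : IsBoundedUnder (· ≥ ·) atTop Z)
    (hslow : IsSlowlyIncreasing Z)
    (hdense : Dense (AddSubgroup.closure (range a) : Set ℝ)) :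
    I ≤ -((∑ j, p j * a j) * limsup (-Z) atTop) := by
  obtain ⟨A, hA⟩ := Finite.exists_le a
  refine le_neg_of_le_neg (sum_mul_le_of_frequently_le_window hp ha hA (fun s t => (hint s t).neg)
    (by rw [renewalMass_neg]; exact hW.neg) fun e he => ?_)
  obtain ⟨δ, hδ, hδe⟩ := hslow (e / 2) (half_pos he)
  obtain ⟨δ', hδ', hle_δ, hle_e⟩ : ∃ δ' > 0, δ' ≤ δ ∧ δ' ≤ e / 2 :=
    ⟨min δ (e / 2), lt_min hδ (half_pos he), min_le_left _ _, min_le_right _ _⟩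
  refine (h.neg.frequently_limsup_sub_lt hp hp1 (neg_zero (G := ℝ) ▸ hz.neg)
    (isBoundedUnder_le_neg.2 hge) (isBoundedUnder_ge_neg.2 hle) hdense (A + δ')
    hδ').mono fun t ht u hu => ?_
  obtain ⟨x, hx, hlt⟩ := ht (u - δ') ⟨by linarith [hu.1], by linarith [hu.2]⟩
  have hux := hδe x u ⟨by linarith [hx.2], by linarith [hx.1]⟩
  simp only [Pi.neg_apply] at hlt ⊢
  linarith

theorem tendsto_of_dense (h : IsRenewal p a z Z) (hp : ∀ j, 0 < p j) (hp1 : ∑ j, p j = 1)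
    (ha : ∀ j, 0 < a j) (hint : ∀ s t, IntervalIntegrable Z volume s t)
    (hz : Tendsto z atTop (𝓝 0)) (hW : Tendsto (renewalMass p a Z) atTop (𝓝 I))
    (hle : IsBoundedUnder (· ≤ ·) atTop Z) (hge : IsBoundedUnder (· ≥ ·) atTop Z)
    (hslow : IsSlowlyIncreasing Z)
    (hdense : Dense (AddSubgroup.closure (range a) : Set ℝ)) :
    Tendsto Z atTop (𝓝 (I / ∑ j, p j * a j)) := by
  have hμ := sum_mul_pos_of_sum_eq_one hp hp1 ha
  have hupper := h.sum_mul_limsup_le hp hp1 ha hint hz hW hle hge hslow hdense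
  have hlower := h.le_neg_sum_mul_limsup_neg hp hp1 ha hint hz hW hle hge hslow hdense
  refine tendsto_order.2 ⟨fun b hb => ?_, fun b hb => ?_⟩
  · rw [lt_div_iff₀ hμ] at hb
    filter_upwards [eventually_lt_of_limsup_lt (show limsup (-Z) atTop < -b by nlinarith)
      (isBoundedUnder_le_neg.2 hge)] with t ht using neg_lt_neg_iff.1 ht
  · rw [gt_iff_lt, div_lt_iff₀ hμ] at hb
    exact eventually_lt_of_limsup_lt (by nlinarith) hle

end IsRenewal

theorem eq_zero_of_forall_mem_eq_sum (hp : ∀ j, 0 < p j) (hp1 : ∑ j, p j = 1) (ha : ∀ j, 0 < a j)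
    {H : AddSubgroup ℝ} (haH : ∀ j, a j ∈ H) (hZ : ∀ t ∈ H, Z t = ∑ j, p j * Z (t - a j))
    (hbot : Tendsto Z atBot (𝓝 0)) : ∀ t ∈ H, Z t = 0 := by
  intro t ht
  refine abs_nonpos_iff.1 (le_of_forall_pos_le_add fun e he => ?_)
  rw [zero_add]
  obtain ⟨T, hT⟩ := eventually_atBot.1 (Metric.tendsto_nhds.1 hbot e he)
  refine forall_of_forall_sub (P := fun t => t ∈ H → |Z t| ≤ e) ha
    (fun t h _ => by simpa using (hT t h).le) (fun t _ ih htH => ?_) t ht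
  calc |Z t| ≤ ∑ j, |p j * Z (t - a j)| := by
        rw [hZ t htH]
        exact Finset.abs_sum_le_sum_abs _ _
    _ ≤ ∑ j, p j * e := by
        gcongr with j
        rw [abs_mul, abs_of_pos (hp j)]
        exact mul_le_mul_of_nonneg_left (ih j (sub_mem htH (haH j))) (hp j).le
    _ = e := by rw [← Finset.sum_mul, hp1, one_mul]

end Renewal

/-! ### The logarithmic scale -/

/-- The function `ε ↦ ε ^ (-α) * k ε` in the variable `t = -log ε`, in which the scaling relation
of a self-similar tube volume becomes a renewal equation. -/
noncomputable def logRescale (α : ℝ) (k : ℝ → ℝ) (t : ℝ) : ℝ :=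
  Real.exp (α * t) * k (Real.exp (-t))

section LogRescale

variable {α A K V : ℝ} {f h k : ℝ → ℝ}

theorem map_exp_neg_atTop : map (fun t : ℝ => Real.exp (-t)) atTop = 𝓝[>] 0 := by
  rw [← Real.map_exp_atBot, ← map_neg_atTop, map_map]
  rfl

theorem apply_mul_rpow_eq_logRescale (α : ℝ) (k : ℝ → ℝ) (t : ℝ) :
    k (Real.exp (-t)) * Real.exp (-t) ^ (-α) = logRescale α k t := by
  rw [logRescale, ← Real.exp_mul, mul_comm, neg_mul_neg, mul_comm t]

theorem tendsto_logRescale_iff {L : ℝ} :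
    Tendsto (logRescale α k) atTop (𝓝 L) ↔
      Tendsto (fun ε : ℝ => k ε * ε ^ (-α)) (𝓝[>] 0) (𝓝 L) := by
  rw [← map_exp_neg_atTop, tendsto_map'_iff]
  exact tendsto_congr fun t => (apply_mul_rpow_eq_logRescale α k t).symm

theorem logRescale_eq_exp_mul (α β : ℝ) (k : ℝ → ℝ) (t : ℝ) :
    logRescale α k t = Real.exp ((α - β) * t) * logRescale β k t := by
  rw [logRescale, logRescale, ← mul_assoc, ← Real.exp_add]
  ring_nf

theorem isBigO_rpow_iff_logRescale :
    k =O[𝓝[>] 0] (fun ε : ℝ => ε ^ α) ↔ logRescale α k =O[atTop] (1 : ℝ → ℝ) := by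
  have hpow (t : ℝ) : k (Real.exp (-t)) = Real.exp (-t) ^ α * logRescale α k t := by
    rw [logRescale, ← Real.exp_mul, ← mul_assoc, ← Real.exp_add]
    simp [mul_comm]
  have hne (t : ℝ) : Real.exp (-t) ^ α ≠ 0 := (Real.rpow_pos_of_pos (Real.exp_pos _) α).ne'
  rw [← map_exp_neg_atTop, Asymptotics.isBigO_map, Asymptotics.isBigO_iff, Asymptotics.isBigO_iff]
  refine exists_congr fun C => eventually_congr (Eventually.of_forall fun t => ?_)
  simp only [Function.comp_apply, hpow, norm_mul, Pi.one_apply, norm_one, mul_one]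
  rw [mul_comm, mul_le_mul_iff_left₀ (norm_pos_iff.2 (hne t))]

theorem logRescale_nonneg (hk : ∀ ε, 0 < ε → 0 ≤ k ε) (t : ℝ) : 0 ≤ logRescale α k t :=
  mul_nonneg (Real.exp_pos _).le (hk _ (Real.exp_pos _))

theorem logRescale_mono (hk : ∀ ε, f ε ≤ k ε) (t : ℝ) : logRescale α f t ≤ logRescale α k t :=
  mul_le_mul_of_nonneg_left (hk _) (Real.exp_pos _).le

theorem logRescale_sub (f k : ℝ → ℝ) (t : ℝ) :
    logRescale α (fun ε => k ε - f ε) t = logRescale α k t - logRescale α f t :=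
  mul_sub _ _ _

theorem logRescale_sum {κ : Type*} [Fintype κ] (k : κ → ℝ → ℝ) (t : ℝ) :
    logRescale α (fun ε => ∑ q, k q ε) t = ∑ q, logRescale α (k q) t :=
  Finset.mul_sum _ _ _

theorem isRenewal_logRescale {ι : Type*} [Fintype ι] {r : ι → ℝ} (hr : ∀ j, 0 < r j) {d : ℕ}
    (hf : ∀ ε, f ε = h ε + ∑ j, r j ^ d * f (ε / r j)) (s : ℝ) :
    IsRenewal (fun j => r j ^ s) (fun j => Real.log (r j)⁻¹) (logRescale (d - s) h)
      (logRescale (d - s) f) := fun t => by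
  have hscale (j : ι) : Real.exp (-(t - Real.log (r j)⁻¹)) = Real.exp (-t) / r j := by
    rw [Real.log_inv, sub_neg_eq_add, neg_add', Real.exp_sub, Real.exp_log (hr j)]
  have hweight (j : ι) : r j ^ s * Real.exp ((d - s) * (t - Real.log (r j)⁻¹))
      = Real.exp ((d - s) * t) * r j ^ d := by
    rw [← Real.rpow_natCast (r j) d, Real.rpow_def_of_pos (hr j), Real.rpow_def_of_pos (hr j),
      ← Real.exp_add, ← Real.exp_add, Real.log_inv]
    ring_nf
  simp only [logRescale, hscale, ← mul_assoc, hweight]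
  rw [hf, mul_add, Finset.mul_sum]
  simp only [mul_assoc]

theorem intervalIntegrable_logRescale (hk : Monotone k) (s t : ℝ) :
    IntervalIntegrable (logRescale α k) volume s t := by
  have hanti : Antitone fun t : ℝ => k (Real.exp (-t)) := fun x y hxy =>
    hk (Real.exp_le_exp.2 (neg_le_neg hxy))
  exact hanti.intervalIntegrable.continuousOn_mul (Continuous.continuousOn (by fun_prop))

theorem logRescale_le_exp_mul (hk : Monotone k) (s t : ℝ) (hst : s ≤ t) :
    logRescale α k t ≤ Real.exp (α * (t - s)) * logRescale α k s := by
  rw [logRescale, logRescale, ← mul_assoc, ← Real.exp_add, ← mul_add, sub_add_cancel]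
  exact mul_le_mul_of_nonneg_left (hk (Real.exp_le_exp.2 (neg_le_neg hst))) (Real.exp_pos _).le

theorem logRescale_le_exp_mul_of_le (hk : ∀ ε, k ε ≤ V) (t : ℝ) :
    logRescale α k t ≤ Real.exp (α * t) * V :=
  mul_le_mul_of_nonneg_left (hk _) (Real.exp_pos _).le

theorem logRescale_le_mul_exp (hk : ∀ ε, 0 < ε → ε ≤ 1 → k ε ≤ A * ε) {t : ℝ} (ht : 0 ≤ t) :
    logRescale α k t ≤ A * Real.exp ((α - 1) * t) := by
  calc logRescale α k t ≤ Real.exp (α * t) * (A * Real.exp (-t)) :=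
        mul_le_mul_of_nonneg_left (hk _ (Real.exp_pos _) (by simpa using ht)) (Real.exp_pos _).le
    _ = A * Real.exp ((α - 1) * t) := by
        rw [mul_left_comm, ← Real.exp_add]
        ring_nf

theorem tendsto_logRescale_atBot (hα : 0 < α) (hk₀ : ∀ ε, 0 < ε → 0 ≤ k ε) (hk : ∀ ε, k ε ≤ V) :
    Tendsto (logRescale α k) atBot (𝓝 0) := by
  have hlim : Tendsto (fun t : ℝ => Real.exp (α * t) * V) atBot (𝓝 0) := by
    simpa using (Real.tendsto_exp_atBot.comp (tendsto_id.const_mul_atBot hα)).mul_const V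
  exact squeeze_zero (logRescale_nonneg hk₀) (logRescale_le_exp_mul_of_le hk) hlim

theorem tendsto_logRescale_atTop (hα : α < 1) (hk₀ : ∀ ε, 0 < ε → 0 ≤ k ε)
    (hk : ∀ ε, 0 < ε → ε ≤ 1 → k ε ≤ A * ε) : Tendsto (logRescale α k) atTop (𝓝 0) := by
  have hlim : Tendsto (fun t : ℝ => A * Real.exp ((α - 1) * t)) atTop (𝓝 0) := by
    simpa using (Real.tendsto_exp_atBot.comp
      (tendsto_id.const_mul_atTop_of_neg (sub_neg.2 hα))).const_mul A
  exact squeeze_zero' (Eventually.of_forall (logRescale_nonneg hk₀))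
    ((eventually_ge_atTop 0).mono fun t ht => logRescale_le_mul_exp hk ht) hlim

theorem image_exp_neg_Ico {T : ℝ} (hT : 0 < T) :
    (fun t : ℝ => Real.exp (-t)) '' Ico 0 (Real.log T) = Ioc (1 / T) 1 := by
  have hneg : (fun t : ℝ => -t) '' Ico 0 (Real.log T) = Ioc (-Real.log T) 0 := by
    simp
  have hexp : Real.exp '' Ioc (-Real.log T) 0 = Ioc (1 / T) 1 := by
    ext x
    constructor
    · rintro ⟨t, ht, rfl⟩
      refine ⟨?_, Real.exp_le_one_iff.2 ht.2⟩
      rw [one_div, ← Real.exp_log hT, ← Real.exp_neg]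
      exact Real.exp_lt_exp.2 ht.1
    · intro hx
      have hx₀ : 0 < x := (one_div_pos.2 hT).trans hx.1
      refine ⟨Real.log x, ⟨?_, Real.log_nonpos hx₀.le hx.2⟩, Real.exp_log hx₀⟩
      rw [← Real.log_inv, ← one_div]
      exact Real.log_lt_log (one_div_pos.2 hT) hx.1
  rw [← hexp, ← hneg, image_image]

theorem integral_rpow_mul_div_eq (k : ℝ → ℝ) {T : ℝ} (hT : 1 ≤ T) :
    ∫ ε in (1 / T)..1, ε ^ (-α) * k ε / ε = ∫ t in (0 : ℝ)..Real.log T, logRescale α k t := by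
  have hT₀ : 0 < T := zero_lt_one.trans_le hT
  rw [intervalIntegral.integral_of_le ((div_le_one hT₀).2 hT),
    intervalIntegral.integral_of_le (Real.log_nonneg hT), ← image_exp_neg_Ico hT₀,
    integral_image_eq_integral_abs_deriv_smul measurableSet_Ico
      (f' := fun t => -Real.exp (-t)) (fun t _ => by
        simpa using ((hasDerivAt_id t).neg.exp).hasDerivWithinAt)
      (fun s _ t _ hst => by simpa using hst), integral_Ico_eq_integral_Ioc]
  refine setIntegral_congr_fun measurableSet_Ioc fun t _ => ?_
  simp only [← apply_mul_rpow_eq_logRescale, abs_neg, abs_of_pos (Real.exp_pos _), smul_eq_mul]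
  field_simp

theorem tendsto_average_of_le_mul_exp {X : ℝ → ℝ} (hint : ∀ s t, IntervalIntegrable X volume s t)
    (hX₀ : ∀ t, 0 ≤ X t) {b : ℝ} (hb : b < 0) (hX : ∀ t, 0 ≤ t → X t ≤ K * Real.exp (b * t)) :
    Tendsto (fun T : ℝ => (∫ t in (0 : ℝ)..T, X t) / T) atTop (𝓝 0) := by
  have hexp : IntegrableOn (fun t : ℝ => K * Real.exp (b * t)) (Ioi 0) :=
    (integrableOn_exp_mul_Ioi hb 0).const_mul K
  have hle : ∀ T > 0, ∫ t in (0 : ℝ)..T, X t ≤ ∫ t in Ioi (0 : ℝ), K * Real.exp (b * t) := by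
    intro T hT
    rw [intervalIntegral.integral_of_le hT.le]
    refine (setIntegral_mono_on (hint 0 T).1 (hexp.mono_set Ioc_subset_Ioi_self)
      measurableSet_Ioc fun t ht => hX t ht.1.le).trans
      (setIntegral_mono_set hexp ?_ Ioc_subset_Ioi_self.eventuallyLE)
    exact (ae_restrict_iff' measurableSet_Ioi).2
      (Eventually.of_forall fun t ht => (hX₀ t).trans (hX t (le_of_lt ht)))
  refine squeeze_zero' ?_ ?_ (tendsto_const_nhds.div_atTop tendsto_id : Tendsto
    (fun T : ℝ => (∫ t in Ioi (0 : ℝ), K * Real.exp (b * t)) / T) atTop (𝓝 0))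
  · filter_upwards [eventually_gt_atTop 0] with T hT
    exact div_nonneg (intervalIntegral.integral_nonneg hT.le fun t _ => hX₀ t) hT.le
  · filter_upwards [eventually_gt_atTop 0] with T hT
    exact div_le_div_of_nonneg_right (hle T hT) hT.le

end LogRescale

/-! ### Diphase functions -/

/-- `k` behaves like the inner tube volume of a diphase Steiner-like set in `ℝ^d` with inradius `g`
and coefficients `κ`: it is a polynomial of order at least `1` up to `g`, and the constant
`-κ d` from there on. -/
structure IsDiphase (d : ℕ) (k : ℝ → ℝ) (g : ℝ) (κ : ℕ → ℝ) : Prop where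
  pos : 0 < g
  eq_sum : ∀ ε, 0 < ε → ε < g → k ε = ∑ m ∈ Finset.range d, κ m * ε ^ (d - m)
  eq_neg : ∀ ε, g ≤ ε → k ε = -κ d

namespace IsDiphase

variable {d : ℕ} {k : ℝ → ℝ} {g D : ℝ} {κ : ℕ → ℝ}

theorem logRescale_eq_sum (hk : IsDiphase d k g κ) {t : ℝ} (ht : -Real.log g < t) :
    logRescale (d - D) k t = ∑ m ∈ Finset.range d, κ m * Real.exp ((m - D) * t) := by
  rw [logRescale,
    hk.eq_sum _ (Real.exp_pos _) ((Real.lt_log_iff_exp_lt hk.pos).1 (neg_lt.1 ht)), Finset.mul_sum]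
  refine Finset.sum_congr rfl fun m hm => ?_
  rw [mul_left_comm, ← Real.exp_nat_mul, ← Real.exp_add, Nat.cast_sub (Finset.mem_range.1 hm).le]
  ring_nf

theorem logRescale_eq_neg_mul (hk : IsDiphase d k g κ) {t : ℝ} (ht : t ≤ -Real.log g) :
    logRescale (d - D) k t = -κ d * Real.exp ((d - D) * t) := by
  rw [logRescale, hk.eq_neg _ ((Real.log_le_iff_le_exp hk.pos).1 (le_neg_of_le_neg ht)), mul_comm]

theorem integrableOn_Ioi (hk : IsDiphase d k g κ) (hD : (d : ℝ) - 1 < D) :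
    IntegrableOn (logRescale (d - D) k) (Ioi (-Real.log g)) ∧
      ∫ t in Ioi (-Real.log g), logRescale (d - D) k t
        = ∑ m ∈ Finset.range d, g ^ (D - m) / (D - m) * κ m := by
  have hneg : ∀ m ∈ Finset.range d, (m : ℝ) - D < 0 := fun m hm => by
    have : (m : ℝ) + 1 ≤ d := by exact_mod_cast Finset.mem_range.1 hm
    linarith
  have heq : EqOn (fun t => ∑ m ∈ Finset.range d, κ m * Real.exp ((m - D) * t))
      (logRescale (d - D) k) (Ioi (-Real.log g)) := fun t ht => (hk.logRescale_eq_sum ht).symm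
  have hint : ∀ m ∈ Finset.range d,
      IntegrableOn (fun t => κ m * Real.exp ((m - D) * t)) (Ioi (-Real.log g)) :=
    fun m hm => (integrableOn_exp_mul_Ioi (hneg m hm) _).const_mul _
  refine ⟨IntegrableOn.congr_fun (integrable_finsetSum _ hint) heq measurableSet_Ioi, ?_⟩
  rw [← setIntegral_congr_fun measurableSet_Ioi heq, integral_finsetSum _ hint]
  refine Finset.sum_congr rfl fun m hm => ?_
  rw [integral_const_mul, integral_exp_mul_Ioi (hneg m hm), Real.rpow_def_of_pos hk.pos, neg_div,
    ← div_neg, neg_sub, mul_comm]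
  ring_nf

theorem integrableOn_Iic (hk : IsDiphase d k g κ) (hD : D < d) :
    IntegrableOn (logRescale (d - D) k) (Iic (-Real.log g)) ∧
      ∫ t in Iic (-Real.log g), logRescale (d - D) k t = g ^ (D - d) / (D - d) * κ d := by
  have hpos : 0 < (d : ℝ) - D := sub_pos.2 hD
  have heq : EqOn (fun t => -κ d * Real.exp ((d - D) * t))
      (logRescale (d - D) k) (Iic (-Real.log g)) := fun t ht => (hk.logRescale_eq_neg_mul ht).symm
  refine ⟨IntegrableOn.congr_fun ((integrableOn_exp_mul_Iic hpos _).const_mul _) heq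
    measurableSet_Iic, ?_⟩
  rw [← setIntegral_congr_fun measurableSet_Iic heq, integral_const_mul, integral_exp_mul_Iic hpos,
    Real.rpow_def_of_pos hk.pos, show (d - D) * -Real.log g = Real.log g * (D - d) by ring,
    ← neg_sub D d, div_neg]
  ring

theorem integrable_logRescale (hk : IsDiphase d k g κ) (hD : (d : ℝ) - 1 < D) (hDd : D < d) :
    Integrable (logRescale (d - D) k) := by
  rw [← integrableOn_univ, ← Iic_union_Ioi (a := -Real.log g)]
  exact (hk.integrableOn_Iic hDd).1.union (hk.integrableOn_Ioi hD).1

theorem integral_logRescale (hk : IsDiphase d k g κ) (hD : (d : ℝ) - 1 < D) (hDd : D < d) :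
    ∫ t, logRescale (d - D) k t = ∑ m ∈ Finset.range (d + 1), g ^ (D - m) / (D - m) * κ m := by
  obtain ⟨hIic, hIic_eq⟩ := hk.integrableOn_Iic hDd
  obtain ⟨hIoi, hIoi_eq⟩ := hk.integrableOn_Ioi hD
  rw [← intervalIntegral.integral_Iic_add_Ioi hIic hIoi, hIic_eq, hIoi_eq, Finset.sum_range_succ,
    add_comm]

theorem exists_le_mul (hk : IsDiphase d k g κ) :
    ∃ A, ∀ ε, 0 < ε → ε ≤ 1 → k ε ≤ A * ε := by
  have hg := hk.pos
  refine ⟨∑ m ∈ Finset.range d, |κ m| + |κ d| / g, fun ε hε hε₁ => ?_⟩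
  rw [add_mul]
  rcases lt_or_ge ε g with hεg | hεg
  · rw [hk.eq_sum ε hε hεg, Finset.sum_mul]
    refine le_add_of_le_of_nonneg (Finset.sum_le_sum fun m hm => ?_) (by positivity)
    have hpow : ε ^ (d - m) ≤ ε :=
      pow_le_of_le_one hε.le hε₁ (Nat.sub_pos_of_lt (Finset.mem_range.1 hm)).ne'
    calc κ m * ε ^ (d - m) ≤ |κ m| * ε ^ (d - m) := by gcongr; exact le_abs_self _
      _ ≤ |κ m| * ε := by gcongr
  · calc k ε ≤ |κ d| := by rw [hk.eq_neg ε hεg]; exact neg_le_abs _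
      _ = |κ d| / g * g := (div_mul_cancel₀ _ hg.ne').symm
      _ ≤ |κ d| / g * ε := by gcongr
      _ ≤ _ := le_add_of_nonneg_left (by positivity)

end IsDiphase

/-! ### The lattice case -/

section Lattice

theorem eventually_add_lt_of_mem_zmultiples {η : ℝ} (hη : 0 < η) (c : ℝ) :
    ∀ᶠ τ : ℝ in 𝓝[>] 0, ∀ t ∈ AddSubgroup.zmultiples η, c < t → c + τ < t := by
  have hpos : 0 < (⌊c / η⌋ + 1) * η - c :=
    sub_pos.2 ((div_lt_iff₀ hη).1 (Int.lt_floor_add_one (c / η)))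
  filter_upwards [nhdsWithin_le_nhds (eventually_lt_nhds hpos)] with τ hτ t ht hct
  obtain ⟨n, rfl⟩ := AddSubgroup.mem_zmultiples_iff.1 ht
  rw [zsmul_eq_mul] at hct ⊢
  have hn : ⌊c / η⌋ + 1 ≤ n := Int.add_one_le_iff.2 (Int.floor_lt.2 ((div_lt_iff₀ hη).2 hct))
  have : ((⌊c / η⌋ : ℝ) + 1) * η ≤ n * η := by gcongr; exact_mod_cast hn
  linarith

/-- The combination `∑ i, c i * Z (t - i * δ)` of translates of `Z` with the coefficients `c i` of
the polynomial `P`. -/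
noncomputable def shiftSum (P : Polynomial ℝ) (δ : ℝ) (Z : ℝ → ℝ) (t : ℝ) : ℝ :=
  P.sum fun i c => c * Z (t - i * δ)

variable {P : Polynomial ℝ} {δ : ℝ} {z Z : ℝ → ℝ}

theorem shiftSum_congr {f : ℝ → ℝ} {t : ℝ}
    (h : ∀ i ≤ P.natDegree, Z (t - i * δ) = f (t - i * δ)) : shiftSum P δ Z t = shiftSum P δ f t :=
  Finset.sum_congr rfl fun i hi => congrArg _ (h i (Polynomial.le_natDegree_of_mem_supp i hi))

theorem shiftSum_const_mul (c : ℝ) (f : ℝ → ℝ) (t : ℝ) :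
    shiftSum P δ (fun u => c * f u) t = c * shiftSum P δ f t := by
  simp only [shiftSum, Polynomial.sum, Finset.mul_sum, mul_left_comm]

theorem shiftSum_sum {κ : Type*} (s : Finset κ) (f : κ → ℝ → ℝ) (t : ℝ) :
    shiftSum P δ (fun u => ∑ q ∈ s, f q u) t = ∑ q ∈ s, shiftSum P δ (f q) t := by
  simp only [shiftSum, Polynomial.sum, Finset.mul_sum]
  exact Finset.sum_comm

theorem shiftSum_exp (x t : ℝ) :
    shiftSum P δ (fun u => Real.exp (x * u)) t
      = Real.exp (x * t) * P.eval (Real.exp (-(x * δ))) := by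
  rw [shiftSum, Polynomial.eval_eq_sum, Polynomial.sum, Polynomial.sum, Finset.mul_sum]
  refine Finset.sum_congr rfl fun i _ => ?_
  rw [mul_left_comm, ← Real.exp_nat_mul, ← Real.exp_add]
  ring_nf

theorem tendsto_shiftSum {l : Filter ℝ} (hl : ∀ x, Tendsto (fun t => t - x) l l) {L : ℝ}
    (hZ : Tendsto Z l (𝓝 L)) : Tendsto (shiftSum P δ Z) l (𝓝 (P.eval 1 * L)) := by
  rw [Polynomial.eval_eq_sum, Polynomial.sum, Finset.sum_mul]
  simp only [one_pow, mul_one]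
  exact tendsto_finsetSum _ fun i _ => (hZ.comp (hl _)).const_mul _

theorem IsRenewal.shiftSum {ι : Type*} [Fintype ι] {p a : ι → ℝ} (h : IsRenewal p a z Z) :
    IsRenewal p a (shiftSum P δ z) (shiftSum P δ Z) := fun t => by
  simp only [Fractal.shiftSum, Polynomial.sum, Finset.mul_sum]
  rw [Finset.sum_comm, ← Finset.sum_add_distrib]
  refine Finset.sum_congr rfl fun i _ => ?_
  rw [h, mul_add, Finset.mul_sum]
  simp only [mul_left_comm, sub_right_comm]

theorem exists_polynomial_eval_exp_eq_zero (s : Finset ℕ) {x : ℕ → ℝ} (hx : ∀ m ∈ s, x m ≠ 0)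
    (hδ : δ ≠ 0) : ∃ P : Polynomial ℝ, P.natDegree = s.card ∧ P.eval 1 ≠ 0 ∧
      ∀ m ∈ s, P.eval (Real.exp (-(x m * δ))) = 0 := by
  refine ⟨∏ m ∈ s, (Polynomial.X - Polynomial.C (Real.exp (-(x m * δ)))), ?_, ?_, fun m hm => ?_⟩
  · rw [Polynomial.natDegree_prod_of_monic _ _ fun m _ => Polynomial.monic_X_sub_C _]
    simp
  · rw [Polynomial.eval_prod]
    refine Finset.prod_ne_zero_iff.2 fun m hm => ?_
    rw [Polynomial.eval_sub, Polynomial.eval_X, Polynomial.eval_C, sub_ne_zero, ne_comm, Ne,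
      Real.exp_eq_one_iff, neg_eq_zero]
    exact mul_ne_zero (hx m hm) hδ
  · rw [Polynomial.eval_prod]
    exact Finset.prod_eq_zero hm (by simp)

theorem IsDiphase.shiftSum_logRescale_eq_zero {d : ℕ} {k : ℝ → ℝ} {g D t : ℝ} {κ : ℕ → ℝ}
    (hk : IsDiphase d k g κ) (hδ : 0 ≤ δ)
    (hP : ∀ m ∈ Finset.range (d + 1), P.eval (Real.exp (-((m - D) * δ))) = 0)
    (ht : -Real.log g < t → -Real.log g + P.natDegree * δ < t) :
    shiftSum P δ (logRescale (d - D) k) t = 0 := by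
  rcases le_or_gt t (-Real.log g) with h | h
  · have hconst : shiftSum P δ (logRescale (d - D) k) t
        = shiftSum P δ (fun u => -κ d * Real.exp ((d - D) * u)) t :=
      shiftSum_congr fun i _ => hk.logRescale_eq_neg_mul
        (by nlinarith [mul_nonneg (Nat.cast_nonneg' i) hδ])
    rw [hconst, shiftSum_const_mul, shiftSum_exp, hP d (Finset.self_mem_range_succ d), mul_zero,
      mul_zero]
  · have hpoly : shiftSum P δ (logRescale (d - D) k) t
        = shiftSum P δ (fun u => ∑ m ∈ Finset.range d, κ m * Real.exp ((m - D) * u)) t :=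
      shiftSum_congr fun i hi => hk.logRescale_eq_sum (by
        have : (i : ℝ) * δ ≤ P.natDegree * δ := by gcongr
        linarith [ht h])
    rw [hpoly, shiftSum_sum]
    refine Finset.sum_eq_zero fun m hm => ?_
    rw [shiftSum_const_mul, shiftSum_exp, hP m (Finset.range_subset_range.2 d.le_succ hm), mul_zero,
      mul_zero]

theorem eq_zero_of_tendsto_of_forall_mem_zmultiples {ι κ : Type*} [Fintype ι] [Fintype κ]
    {p a : ι → ℝ} {d : ℕ} {D η L : ℝ} {k : κ → ℝ → ℝ} {g : κ → ℝ} {c : κ → ℕ → ℝ}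
    (h : IsRenewal p a (fun t => ∑ q, logRescale (d - D) (k q) t) Z) (hp : ∀ j, 0 < p j)
    (hp1 : ∑ j, p j = 1) (ha : ∀ j, 0 < a j) (hk : ∀ q, IsDiphase d (k q) (g q) (c q))
    (hD : ∀ m ∈ Finset.range (d + 1), (m : ℝ) - D ≠ 0) (hη : 0 < η)
    (haη : ∀ j, a j ∈ AddSubgroup.zmultiples η) (hbot : Tendsto Z atBot (𝓝 0))
    (hL : Tendsto Z atTop (𝓝 L)) : L = 0 := by
  obtain ⟨τ, hτ, hτ₀ : 0 < τ⟩ := ((eventually_all.2 fun q =>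
    eventually_add_lt_of_mem_zmultiples hη (-Real.log (g q))).and eventually_mem_nhdsWithin).exists
  have hδ : 0 < τ / (d + 1) := by positivity
  obtain ⟨P, hdeg, hP₁, hP⟩ := exists_polynomial_eval_exp_eq_zero _ hD hδ.ne'
  have hPτ : P.natDegree * (τ / (d + 1)) = τ := by
    rw [hdeg, Finset.card_range]
    push_cast
    field_simp
  have hsource : ∀ t ∈ AddSubgroup.zmultiples η,
      shiftSum P (τ / (d + 1)) (fun t => ∑ q, logRescale (d - D) (k q) t) t = 0 := fun t ht => by
    rw [shiftSum_sum]
    exact Finset.sum_eq_zero fun q _ =>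
      (hk q).shiftSum_logRescale_eq_zero hδ.le hP (hPτ.symm ▸ hτ q t ht)
  have hbot' := tendsto_shiftSum (P := P) (δ := τ / (d + 1))
    (fun x => tendsto_atBot_add_const_right atBot (-x) tendsto_id) hbot
  rw [mul_zero] at hbot'
  have hzero : ∀ t ∈ AddSubgroup.zmultiples η, shiftSum P (τ / (d + 1)) Z t = 0 :=
    eq_zero_of_forall_mem_eq_sum hp hp1 ha haη
      (fun t ht => by rw [h.shiftSum t, hsource t ht, zero_add]) hbot'
  have hlim := (tendsto_shiftSum (P := P) (δ := τ / (d + 1)) tendsto_sub_const_atTop hL).comp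
    (tendsto_natCast_atTop_atTop.atTop_mul_const hη)
  refine (mul_eq_zero.1 (tendsto_nhds_unique (hlim.congr fun n => ?_)
    tendsto_const_nhds)).resolve_left hP₁
  exact hzero _ (AddSubgroup.mem_zmultiples_iff.2 ⟨n, by simp⟩)

end Lattice

/-! ### The Minkowski dimension -/

section Dimension

variable {ι : Type*} [Fintype ι] {d : ℕ} {r : ι → ℝ} {A : Set (Euc d)} {t : ℝ}

theorem exists_moran_exponent [Nontrivial ι] (hr : ∀ j, 0 < r j) (hlt : ∑ j, r j ^ d < 1) :
    ∃ D : ℝ, 0 < D ∧ D < d ∧ ∑ j, r j ^ D = 1 := by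
  have hcont : Continuous fun s : ℝ => ∑ j, r j ^ s :=
    continuous_finsetSum _ fun j _ => Real.continuous_const_rpow (hr j).ne'
  have h₀ : 1 < ∑ j, r j ^ (0 : ℝ) := by
    simpa using Fintype.one_lt_card (α := ι)
  have hd : ∑ j, r j ^ (d : ℝ) < 1 := by simpa only [Real.rpow_natCast] using hlt
  obtain ⟨D, hD, hsum⟩ := intermediate_value_Ioo' (Nat.cast_nonneg d) hcont.continuousOn ⟨hd, h₀⟩
  exact ⟨D, hD.1, hD.2, hsum⟩

theorem sum_rpow_lt_sum_rpow [Nonempty ι] (hr : ∀ j, 0 < r j) (hr₁ : ∀ j, r j < 1) {s : ℝ}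
    (hst : s < t) : ∑ j, r j ^ t < ∑ j, r j ^ s :=
  Finset.sum_lt_sum_of_nonempty Finset.univ_nonempty fun j _ =>
    Real.rpow_lt_rpow_of_exponent_gt (hr j) (hr₁ j) hst

theorem minkowskiDim_le (ht : 0 ≤ t)
    (hO : logRescale (d - t) (tubeVolume A) =O[atTop] (1 : ℝ → ℝ)) : minkowskiDim A ≤ t :=
  csInf_le ⟨0, fun _ hs => hs.1⟩ ⟨ht, isBigO_rpow_iff_logRescale.2 hO⟩

theorem le_minkowskiDim (hA : Bornology.IsBounded A) {c D : ℝ} (hc : 0 < c)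
    (hle : ∀ᶠ u in atTop, c ≤ logRescale (d - D) (tubeVolume A) u) : D ≤ minkowskiDim A := by
  refine le_csInf ⟨d, Nat.cast_nonneg d, ?_⟩ fun t ht => ?_
  · refine Asymptotics.IsBigO.of_bound (tubeVolume A 1) ?_
    filter_upwards [Ioc_mem_nhdsGT one_pos] with ε hε
    rw [Real.norm_of_nonneg (show 0 ≤ tubeVolume A ε from measureReal_nonneg), sub_self,
      Real.rpow_zero, norm_one, mul_one]
    exact tubeVolume_mono hA hε.2
  · by_contra! htD
    have hexp : Tendsto (fun u : ℝ => Real.exp ((t - D) * u)) atTop (𝓝 0) :=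
      Real.tendsto_exp_atBot.comp (tendsto_id.const_mul_atTop_of_neg (sub_neg.2 htD))
    have hlim : Tendsto (logRescale (d - D) (tubeVolume A)) atTop (𝓝 0) := by
      refine (hexp.zero_mul_isBoundedUnder_le
        ((Asymptotics.isBigO_one_iff ℝ).1 (isBigO_rpow_iff_logRescale.1 ht.2))).congr fun u => ?_
      rw [logRescale_eq_exp_mul (d - D) (d - t), sub_sub_sub_cancel_left]
    exact hc.not_ge (ge_of_tendsto hlim hle)

theorem tendsto_sub_log_div_log {k : ℝ → ℝ} {α b B c : ℝ} (hc : 0 < c)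
    (hk : ∀ᶠ t in atTop, logRescale α k t ∈ Icc c B) :
    Tendsto (fun ε : ℝ => b - Real.log (k ε) / Real.log ε) (𝓝[>] 0) (𝓝 (b - α)) := by
  rw [← map_exp_neg_atTop, tendsto_map'_iff]
  have hlog : Tendsto (fun t => Real.log (logRescale α k t) / t) atTop (𝓝 0) := by
    refine tendsto_of_tendsto_of_tendsto_of_le_of_le'
      (tendsto_const_nhds.div_atTop tendsto_id : Tendsto (fun t => Real.log c / t) _ _)
      (tendsto_const_nhds.div_atTop tendsto_id : Tendsto (fun t => Real.log B / t) _ _) ?_ ?_ <;>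
    filter_upwards [hk, eventually_gt_atTop 0] with t ht ht₀
    · gcongr
      exact ht.1
    · have := hc.trans_le ht.1
      gcongr
      exact ht.2
  refine (show Tendsto (fun t => b - α + Real.log (logRescale α k t) / t) atTop _ by
    simpa using hlog.const_add (b - α)).congr' ?_
  filter_upwards [hk, eventually_gt_atTop 0] with t ht ht₀
  have hkt : k (Real.exp (-t)) ≠ 0 := right_ne_zero_of_mul (hc.trans_le ht.1).ne'
  rw [Function.comp_apply, logRescale, Real.log_mul (Real.exp_pos _).ne' hkt, Real.log_exp,
    Real.log_exp]
  field_simp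
  ring

end Dimension

/-! ### Tube volumes satisfying a scaling relation -/

/-- The analytic properties of the tube volume `v` of a self-similar fractal in `ℝ^d` with scaling
ratios `r`: up to an error `O(ε)` it is a function `f` (the tube volume inside the hull) that is
reproduced by its rescaled copies up to the contributions `k q` of the generators, which have
inradii `g q` and coefficients `c q`. -/
structure IsSelfSimilarTube {ι κ : Type*} [Fintype ι] [Fintype κ] (d : ℕ) (r : ι → ℝ)
    (v f : ℝ → ℝ) (k : κ → ℝ → ℝ) (g : κ → ℝ) (c : κ → ℕ → ℝ) : Prop where
  ratio_pos : ∀ j, 0 < r j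
  ratio_lt_one : ∀ j, r j < 1
  monotone_outer : Monotone v
  monotone_inner : Monotone f
  inner_pos : ∀ ε, 0 < ε → 0 < f ε
  exists_inner_le : ∃ V, ∀ ε, f ε ≤ V
  inner_le_outer : ∀ ε, f ε ≤ v ε
  exists_outer_le : ∃ K, ∀ ε, 0 ≤ ε → ε ≤ 1 → v ε ≤ f ε + K * ε
  inner_eq : ∀ ε, f ε = ∑ q, k q ε + ∑ j, r j ^ d * f (ε / r j)
  isDiphase : ∀ q, IsDiphase d (k q) (g q) (c q)
  nonneg : ∀ q ε, 0 ≤ k q ε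

namespace IsSelfSimilarTube

variable {ι κ : Type*} [Fintype ι] [Fintype κ] {d : ℕ} {r : ι → ℝ} {v f : ℝ → ℝ} {k : κ → ℝ → ℝ}
  {g : κ → ℝ} {c : κ → ℕ → ℝ} {D : ℝ}

theorem log_inv_pos (h : IsSelfSimilarTube d r v f k g c) (j : ι) : 0 < Real.log (r j)⁻¹ :=
  Real.log_pos ((one_lt_inv₀ (h.ratio_pos j)).2 (h.ratio_lt_one j))

theorem rpow_pos (h : IsSelfSimilarTube d r v f k g c) (s : ℝ) (j : ι) : 0 < r j ^ s :=
  Real.rpow_pos_of_pos (h.ratio_pos j) s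

theorem isRenewal (h : IsSelfSimilarTube d r v f k g c) (s : ℝ) :
    IsRenewal (fun j => r j ^ s) (fun j => Real.log (r j)⁻¹)
      (fun t => ∑ q, logRescale (d - s) (k q) t) (logRescale (d - s) f) := by
  simpa only [funext (logRescale_sum k)] using isRenewal_logRescale h.ratio_pos h.inner_eq s

theorem sum_logRescale_nonneg (h : IsSelfSimilarTube d r v f k g c) (α t : ℝ) :
    0 ≤ ∑ q, logRescale α (k q) t :=
  Finset.sum_nonneg fun q _ => logRescale_nonneg (fun ε _ => h.nonneg q ε) t

theorem inner_nonneg (h : IsSelfSimilarTube d r v f k g c) (ε : ℝ) (hε : 0 < ε) : 0 ≤ f ε :=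
  (h.inner_pos ε hε).le

theorem outer_nonneg (h : IsSelfSimilarTube d r v f k g c) (ε : ℝ) (hε : 0 < ε) : 0 ≤ v ε :=
  (h.inner_nonneg ε hε).trans (h.inner_le_outer ε)

theorem exists_logRescale_inner_le (h : IsSelfSimilarTube d r v f k g c) {s : ℝ}
    (hs : ∑ j, r j ^ s < 1) (hs₀ : d - 1 ≤ s) (hsd : s ≤ d) :
    ∃ B, ∀ t, logRescale (d - s) f t ≤ B := by
  obtain ⟨V, hV⟩ := h.exists_inner_le
  choose A hA using fun q => (h.isDiphase q).exists_le_mul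
  have hV₀ : 0 ≤ V := (h.inner_nonneg 1 one_pos).trans (hV 1)
  refine ⟨_, (h.isRenewal s).le_of_sum_lt_one (h.rpow_pos s) hs h.log_inv_pos (T := 0) (V := V)
    (B := ∑ q, |A q|) (fun t ht => ?_) fun t ht => Finset.sum_le_sum fun q _ => ?_⟩
  · refine (logRescale_le_exp_mul_of_le hV t).trans (mul_le_of_le_one_left hV₀ ?_)
    exact Real.exp_le_one_iff.2 (mul_nonpos_of_nonneg_of_nonpos (sub_nonneg.2 hsd) ht)
  · refine (logRescale_le_mul_exp (hA q) ht.le).trans ((mul_le_mul_of_nonneg_right (le_abs_self _)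
      (Real.exp_pos _).le).trans (mul_le_of_le_one_right (abs_nonneg _) ?_))
    exact Real.exp_le_one_iff.2 (mul_nonpos_of_nonpos_of_nonneg (by linarith) ht.le)

theorem exists_outer_sub_inner_le (h : IsSelfSimilarTube d r v f k g c) :
    ∃ K, ∀ ε, 0 < ε → ε ≤ 1 → v ε - f ε ≤ K * ε :=
  let ⟨K, hK⟩ := h.exists_outer_le
  ⟨K, fun ε hε hε₁ => sub_le_iff_le_add'.2 (hK ε hε.le hε₁)⟩

theorem isBigO_logRescale_outer (h : IsSelfSimilarTube d r v f k g c) {s : ℝ}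
    (hs : ∑ j, r j ^ s < 1) (hs₀ : d - 1 ≤ s) (hsd : s ≤ d) :
    logRescale (d - s) v =O[atTop] (1 : ℝ → ℝ) := by
  obtain ⟨B, hB⟩ := h.exists_logRescale_inner_le hs hs₀ hsd
  obtain ⟨K, hK⟩ := h.exists_outer_sub_inner_le
  have hK₀ : 0 ≤ K := by linarith [hK 1 one_pos le_rfl, h.inner_le_outer 1]
  refine Asymptotics.IsBigO.of_bound (B + K) ?_
  filter_upwards [eventually_ge_atTop 0] with t ht
  have hexp : Real.exp ((d - s - 1) * t) ≤ 1 :=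
    Real.exp_le_one_iff.2 (mul_nonpos_of_nonpos_of_nonneg (by linarith) ht)
  have hsub := logRescale_le_mul_exp (α := d - s) hK ht
  rw [logRescale_sub] at hsub
  rw [Real.norm_of_nonneg (logRescale_nonneg h.outer_nonneg t), Pi.one_apply, norm_one, mul_one]
  linarith [hB t, mul_le_of_le_one_right hK₀ hexp]

theorem exists_le_logRescale_inner (h : IsSelfSimilarTube d r v f k g c) (hD : ∑ j, r j ^ D = 1)
    (hDd : D ≤ d) : ∃ b > 0, ∀ t, 0 ≤ t → b ≤ logRescale (d - D) f t := by
  obtain ⟨A, hA⟩ := Finite.exists_le fun j => Real.log (r j)⁻¹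
  refine ⟨f (Real.exp (-A)), h.inner_pos _ (Real.exp_pos _), fun t ht =>
    (h.isRenewal D).le_of_sum_eq_one (h.rpow_pos D) hD h.log_inv_pos hA (T := A) (fun u hu => ?_)
      (fun u _ => h.sum_logRescale_nonneg _ u) (by simpa using ht)⟩
  have hu₀ : 0 ≤ u := by simpa using hu.1
  calc f (Real.exp (-A)) ≤ f (Real.exp (-u)) :=
        h.monotone_inner (Real.exp_le_exp.2 (neg_le_neg hu.2))
    _ ≤ logRescale (d - D) f u := le_mul_of_one_le_left (h.inner_nonneg _ (Real.exp_pos _))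
        (Real.one_le_exp (mul_nonneg (sub_nonneg.2 hDd) hu₀))

theorem minkowskiDim_eq {F : Set (Euc d)} (hF : Bornology.IsBounded F)
    (h : IsSelfSimilarTube d r (tubeVolume F) f k g c) (hD : ∑ j, r j ^ D = 1) (hD₀ : 0 ≤ D)
    (hDd : D < d) (hdim : d - 1 < minkowskiDim F) : minkowskiDim F = D := by
  obtain ⟨b, hb, hbf⟩ := h.exists_le_logRescale_inner hD hDd.le
  refine le_antisymm ?_ (le_minkowskiDim hF hb ((eventually_ge_atTop 0).mono fun t ht =>
    (hbf t ht).trans (logRescale_mono h.inner_le_outer t)))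
  by_contra! hlt
  obtain ⟨t, ht, htd⟩ := exists_between (max_lt (lt_min hlt hDd) (lt_min hdim (sub_one_lt (d : ℝ))))
  rw [max_lt_iff] at ht
  rw [lt_min_iff] at htd
  have : Nonempty ι := Finset.univ_nonempty_iff.1
    (Finset.nonempty_of_sum_ne_zero (hD.trans_ne one_ne_zero))
  refine (minkowskiDim_le (hD₀.trans ht.1.le) ?_).not_gt htd.1
  exact h.isBigO_logRescale_outer (hD ▸ sum_rpow_lt_sum_rpow h.ratio_pos h.ratio_lt_one ht.1)
    ht.2.le htd.2.le

end IsSelfSimilarTube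

theorem natCast_ne_of_mem_range {d m : ℕ} {D : ℝ} (hdD : d - 1 < D) (hDd : D < d)
    (hm : m ∈ Finset.range (d + 1)) : (m : ℝ) ≠ D := by
  rcases (Finset.mem_range_succ_iff.1 hm).eq_or_lt with rfl | hmd
  · exact hDd.ne'
  · have : (m : ℝ) + 1 ≤ d := by exact_mod_cast hmd
    linarith

namespace IsSelfSimilarTube

variable {ι κ : Type*} [Fintype ι] [Fintype κ] {d : ℕ} {r : ι → ℝ} {v f : ℝ → ℝ} {k : κ → ℝ → ℝ}
  {g : κ → ℝ} {c : κ → ℕ → ℝ} {D L : ℝ}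

theorem tendsto_inner_iff (h : IsSelfSimilarTube d r v f k g c) (hdD : d - 1 < D) :
    Tendsto (logRescale (d - D) f) atTop (𝓝 L) ↔
      Tendsto (fun ε => v ε * ε ^ (D - d)) (𝓝[>] 0) (𝓝 L) := by
  obtain ⟨K, hK⟩ := h.exists_outer_sub_inner_le
  have hdiff := tendsto_logRescale_atTop (α := d - D) (by linarith)
    (fun ε _ => sub_nonneg.2 (h.inner_le_outer ε)) hK
  rw [← neg_sub (d : ℝ) D, ← tendsto_logRescale_iff]
  constructor <;> intro hL
  · simpa [logRescale_sub] using hL.add hdiff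
  · simpa [logRescale_sub] using hL.sub hdiff

theorem tendsto_inner_atBot (h : IsSelfSimilarTube d r v f k g c) (hDd : D < d) :
    Tendsto (logRescale (d - D) f) atBot (𝓝 0) :=
  let ⟨_, hV⟩ := h.exists_inner_le
  tendsto_logRescale_atBot (sub_pos.2 hDd) h.inner_nonneg hV

theorem tendsto_source_atTop (h : IsSelfSimilarTube d r v f k g c) (hdD : d - 1 < D) :
    Tendsto (fun t => ∑ q, logRescale (d - D) (k q) t) atTop (𝓝 0) := by
  rw [← Finset.sum_const_zero (s := Finset.univ (α := κ))]
  refine tendsto_finsetSum _ fun q _ => ?_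
  obtain ⟨A, hA⟩ := (h.isDiphase q).exists_le_mul
  exact tendsto_logRescale_atTop (by linarith) (fun ε _ => h.nonneg q ε) hA

theorem tendsto_renewalMass (h : IsSelfSimilarTube d r v f k g c) (hD : ∑ j, r j ^ D = 1)
    (hdD : d - 1 < D) (hDd : D < d) :
    Tendsto (renewalMass (fun j => r j ^ D) (fun j => Real.log (r j)⁻¹) (logRescale (d - D) f))
      atTop (𝓝 (∑ q, ∑ m ∈ Finset.range (d + 1), g q ^ (D - m) / (D - m) * c q m)) := by
  have hint (q : κ) := (h.isDiphase q).integrable_logRescale hdD hDd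
  convert (h.isRenewal D).tendsto_renewalMass hD (intervalIntegrable_logRescale h.monotone_inner)
    (integrable_finsetSum _ fun q _ => hint q) (h.tendsto_inner_atBot hDd) using 2
  rw [integral_finsetSum _ fun q _ => hint q]
  exact Finset.sum_congr rfl fun q _ => ((h.isDiphase q).integral_logRescale hdD hDd).symm

theorem bddAbove_inner (h : IsSelfSimilarTube d r v f k g c) (hD : ∑ j, r j ^ D = 1)
    (hdD : d - 1 < D) (hDd : D < d) : BddAbove (range (logRescale (d - D) f)) := by
  have hα : 0 ≤ (d : ℝ) - D := sub_nonneg.2 hDd.le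
  obtain ⟨V, hV⟩ := h.exists_inner_le
  refine bddAbove_of_tendsto_renewalMass (h.rpow_pos D) hD h.log_inv_pos
    (intervalIntegrable_logRescale h.monotone_inner) (h.tendsto_renewalMass hD hdD hDd)
    (logRescale_nonneg h.inner_nonneg) hα (logRescale_le_exp_mul h.monotone_inner) fun T =>
    ⟨Real.exp ((d - D) * T) * V, forall_mem_image.2 fun t ht => ?_⟩
  refine (logRescale_le_exp_mul_of_le hV t).trans (mul_le_mul_of_nonneg_right
    (Real.exp_le_exp.2 (mul_le_mul_of_nonneg_left ht hα)) ?_)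
  exact (h.inner_nonneg 1 one_pos).trans (hV 1)

theorem tendsto_sub_log_div_log (h : IsSelfSimilarTube d r v f k g c) (hD : ∑ j, r j ^ D = 1)
    (hdD : d - 1 < D) (hDd : D < d) :
    Tendsto (fun ε : ℝ => d - Real.log (v ε) / Real.log ε) (𝓝[>] 0) (𝓝 D) := by
  obtain ⟨B, hB⟩ := h.bddAbove_inner hD hdD hDd
  obtain ⟨b, hb, hbf⟩ := h.exists_le_logRescale_inner hD hDd.le
  obtain ⟨K, hK⟩ := h.exists_outer_sub_inner_le
  have hdiff := (tendsto_logRescale_atTop (α := d - D) (by linarith)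
    (fun ε _ => sub_nonneg.2 (h.inner_le_outer ε)) hK).eventually_le_const zero_lt_one
  rw [← sub_sub_cancel (d : ℝ) D]
  refine Fractal.tendsto_sub_log_div_log (B := B + 1) hb ?_
  filter_upwards [eventually_ge_atTop 0, hdiff] with t ht htd
  rw [logRescale_sub] at htd
  refine ⟨(hbf t ht).trans (logRescale_mono h.inner_le_outer t), ?_⟩
  linarith [hB (mem_range_self t)]

theorem tendsto_inner_of_dense (h : IsSelfSimilarTube d r v f k g c) (hD : ∑ j, r j ^ D = 1)
    (hdD : d - 1 < D) (hDd : D < d)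
    (hdense : Dense (AddSubgroup.closure (range fun j => Real.log (r j)⁻¹) : Set ℝ)) :
    Tendsto (logRescale (d - D) f) atTop
      (𝓝 ((∑ q, ∑ m ∈ Finset.range (d + 1), g q ^ (D - m) / (D - m) * c q m) /
        ∑ j, r j ^ D * Real.log (r j)⁻¹)) := by
  have hnonneg := logRescale_nonneg (α := d - D) h.inner_nonneg
  have hbdd := h.bddAbove_inner hD hdD hDd
  exact (h.isRenewal D).tendsto_of_dense (h.rpow_pos D) hD h.log_inv_pos
    (intervalIntegrable_logRescale h.monotone_inner) (h.tendsto_source_atTop hdD)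
    (h.tendsto_renewalMass hD hdD hDd) hbdd.isBoundedUnder_of_range
    (isBoundedUnder_of ⟨0, hnonneg⟩)
    (isSlowlyIncreasing_of_le_exp_mul (sub_nonneg.2 hDd.le) hnonneg hbdd
      (logRescale_le_exp_mul h.monotone_inner)) hdense

theorem ne_zero_of_tendsto_inner (h : IsSelfSimilarTube d r v f k g c) (hD : ∑ j, r j ^ D = 1)
    (hDd : D ≤ d) (hL : Tendsto (logRescale (d - D) f) atTop (𝓝 L)) : L ≠ 0 := by
  obtain ⟨b, hb, hbf⟩ := h.exists_le_logRescale_inner hD hDd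
  exact (hb.trans_le (ge_of_tendsto hL ((eventually_ge_atTop 0).mono hbf))).ne'

theorem not_tendsto_inner_of_forall_mem_zmultiples (h : IsSelfSimilarTube d r v f k g c)
    (hD : ∑ j, r j ^ D = 1) (hdD : d - 1 < D) (hDd : D < d) {η : ℝ} (hη : 0 < η)
    (hrη : ∀ j, Real.log (r j)⁻¹ ∈ AddSubgroup.zmultiples η) :
    ¬ Tendsto (logRescale (d - D) f) atTop (𝓝 L) := fun hL =>
  h.ne_zero_of_tendsto_inner hD hDd.le hL (eq_zero_of_tendsto_of_forall_mem_zmultiples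
    (h.isRenewal D) (h.rpow_pos D) hD h.log_inv_pos h.isDiphase
    (fun _ hm => sub_ne_zero.2 (natCast_ne_of_mem_range hdD hDd hm)) hη hrη
    (h.tendsto_inner_atBot hDd) hL)

theorem tendsto_average_outer (h : IsSelfSimilarTube d r v f k g c) (hD : ∑ j, r j ^ D = 1)
    (hdD : d - 1 < D) (hDd : D < d) :
    Tendsto (fun T : ℝ => 1 / Real.log T * ∫ ε in (1 / T)..1, ε ^ (-((d : ℝ) - D)) * v ε / ε) atTop
      (𝓝 ((∑ q, ∑ m ∈ Finset.range (d + 1), g q ^ (D - m) / (D - m) * c q m) /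
        ∑ j, r j ^ D * Real.log (r j)⁻¹)) := by
  obtain ⟨K, hK⟩ := h.exists_outer_sub_inner_le
  have hf := intervalIntegrable_logRescale (α := d - D) h.monotone_inner
  have hv := intervalIntegrable_logRescale (α := d - D) h.monotone_outer
  have hinner := tendsto_average_of_tendsto_renewalMass (h.rpow_pos D) hD h.log_inv_pos hf
    (h.tendsto_renewalMass hD hdD hDd)
  have hdiff := tendsto_average_of_le_mul_exp (X := fun t => logRescale (d - D) v t
    - logRescale (d - D) f t) (K := K) (b := d - D - 1) (fun s t => (hv s t).sub (hf s t))
    (fun t => sub_nonneg.2 (logRescale_mono h.inner_le_outer t)) (by linarith)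
    fun t ht => (logRescale_sub f v t).symm.trans_le (logRescale_le_mul_exp hK ht)
  have houter := hinner.add hdiff
  simp only [intervalIntegral.integral_sub (hv _ _) (hf _ _), ← add_div, add_sub_cancel,
    add_zero] at houter
  refine (houter.comp Real.tendsto_log_atTop).congr' ?_
  filter_upwards [eventually_ge_atTop 1] with T hT
  rw [integral_rpow_mul_div_eq _ hT, Function.comp_apply, one_div_mul_eq_div]

end IsSelfSimilarTube

/-! ### Lattice type -/

section LatticeType

variable {J : ℕ} {r : Fin J → ℝ}

theorem closure_range_log_inv (r : Fin J → ℝ) :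
    AddSubgroup.closure (range fun j => Real.log (r j)⁻¹) =
      AddSubgroup.closure (range fun j => Real.log (r j)) := by
  have hneg : (range fun j => Real.log (r j)⁻¹) = -range fun j => Real.log (r j) := by
    simp only [Real.log_inv, ← image_neg_eq_neg, ← range_comp, Function.comp_def]
  rw [hneg, AddSubgroup.closure_neg]

theorem dense_closure_range_log_inv (h : ¬ IsLatticeType r) :
    Dense (AddSubgroup.closure (range fun j => Real.log (r j)⁻¹) : Set ℝ) := by
  rw [closure_range_log_inv]
  refine (AddSubgroup.dense_or_cyclic _).resolve_right fun ⟨η, hη⟩ => h ?_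
  rw [IsLatticeType, hη, ← AddSubgroup.zmultiples_eq_closure]
  infer_instance

theorem IsLatticeType.exists_forall_mem_zmultiples (h : IsLatticeType r) :
    ∃ η > 0, ∀ j, Real.log (r j)⁻¹ ∈ AddSubgroup.zmultiples η := by
  obtain ⟨η, hη⟩ := (AddSubgroup.isAddCyclic_iff_exists_zmultiples_eq_top _).1
    (AddSubgroup.discrete_iff_addCyclic.2 h)
  have hmem (j : Fin J) : Real.log (r j)⁻¹ ∈ AddSubgroup.zmultiples η := by
    rw [hη, ← closure_range_log_inv]
    exact AddSubgroup.subset_closure (mem_range_self j)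
  rcases lt_trichotomy η 0 with hneg | rfl | hpos
  · exact ⟨-η, neg_pos.2 hneg, by simpa only [AddSubgroup.zmultiples_neg] using hmem⟩
  · simp only [AddSubgroup.zmultiples_zero_eq_bot, AddSubgroup.mem_bot] at hmem
    exact ⟨1, one_pos, fun j => hmem j ▸ zero_mem _⟩
  · exact ⟨η, hpos, hmem⟩

end LatticeType

/-! ### Minkowski content of self-similar fractals -/

section Content

variable {d J Q : ℕ} {φ : Fin J → Euc d → Euc d} {r : Fin J → ℝ} {F : Set (Euc d)}
  {G : Fin Q → Set (Euc d)} {κ : Fin Q → ℕ → ℝ}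

theorem IsOpenPartition.isDiphase [Nonempty (Fin d)] (hG : IsOpenPartition φ F G)
    (hφ : ∀ j, IsSimilitude (φ j) (r j)) (hC : IsClosed (convexHull ℝ F)) {q : Fin Q}
    {c : ℕ → ℝ} (hc : IsSteinerLike (G q) c) :
    IsDiphase d (innerTubeVolume (G q)) (inradius (G q)) c where
  pos := inradius_pos hc.1 hc.2.1 (hG.nonempty q)
  eq_sum := hc.2.2.1
  eq_neg ε hε := by
    rw [hc.2.2.2, neg_neg, ← hG.volumeReal_inter_cthickening_compl hφ hC,
      inter_cthickening_compl_eq_self hc.1 hε]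

theorem IsOpenPartition.isSelfSimilarTube [Nonempty (Fin d)] (hG : IsOpenPartition φ F G)
    (hφ : ∀ j, IsSimilitude (φ j) (r j)) (hF : IsAttractor φ F) (hTSC : TilesetCondition φ F)
    (hPWC : PearseWinterCondition F) (hκ : ∀ q, IsSteinerLike (G q) (κ q)) :
    IsSelfSimilarTube d r (tubeVolume F) (hullTube F) (fun q => innerTubeVolume (G q))
      (fun q => inradius (G q)) κ :=
  have hb := hF.2.1.isBounded
  have hC := hPWC.isCompact_convexHull hb
  { ratio_pos := fun j => (hφ j).1
    ratio_lt_one := fun j => (hφ j).2.1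
    monotone_outer := tubeVolume_mono hb
    monotone_inner := hullTube_mono hb
    inner_pos := fun _ => hullTube_pos hb hTSC.2.1
    exists_inner_le := ⟨_, hullTube_le_volumeReal_convexHull hb⟩
    inner_le_outer := hullTube_le_tubeVolume hb
    exists_outer_le := exists_tubeVolume_le hC hTSC.2.1
    inner_eq := hG.hullTube_eq hφ hF hTSC hPWC
    isDiphase := fun q => hG.isDiphase hφ hC.isClosed (hκ q)
    nonneg := fun _ _ => innerTubeVolume_nonneg _ }

namespace IsSelfSimilarTube

variable {f : ℝ → ℝ} {k : Fin Q → ℝ → ℝ} {g : Fin Q → ℝ}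

theorem hasMinkowskiContent (h : IsSelfSimilarTube d r (tubeVolume F) f k g κ)
    (hD : ∑ j, r j ^ minkowskiDim F = 1) (hdD : d - 1 < minkowskiDim F)
    (hDd : minkowskiDim F < d) (hr : ¬ IsLatticeType r) :
    HasMinkowskiContent F ((∑ q, ∑ m ∈ Finset.range (d + 1),
      g q ^ (minkowskiDim F - m) / (minkowskiDim F - m) * κ q m) /
        ∑ j, r j ^ minkowskiDim F * Real.log (r j)⁻¹) :=
  have hlim := h.tendsto_inner_of_dense hD hdD hDd (dense_closure_range_log_inv hr)
  ⟨h.ne_zero_of_tendsto_inner hD hDd.le hlim, (h.tendsto_inner_iff hdD).1 hlim⟩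

theorem not_isMinkowskiMeasurable (h : IsSelfSimilarTube d r (tubeVolume F) f k g κ)
    (hD : ∑ j, r j ^ minkowskiDim F = 1) (hdD : d - 1 < minkowskiDim F)
    (hDd : minkowskiDim F < d) (hr : IsLatticeType r) : ¬ IsMinkowskiMeasurable F := by
  rintro ⟨L, -, hL⟩
  obtain ⟨η, hη, hrη⟩ := hr.exists_forall_mem_zmultiples
  exact h.not_tendsto_inner_of_forall_mem_zmultiples hD hdD hDd hη hrη
    ((h.tendsto_inner_iff hdD).2 hL)

end IsSelfSimilarTube

end Content

/-! ### Residues of the zeta functions -/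

section Residue

variable {f g N : ℂ → ℂ} {a c : ℂ}

theorem hasResidueAt_of_eventuallyEq (hg : AnalyticAt ℂ g a)
    (hf : f =ᶠ[𝓝[≠] a] fun s => (s - a)⁻¹ * g s) : HasResidueAt f a (g a) := by
  have hmero : MeromorphicAt (fun s => (s - a)⁻¹ * g s) a :=
    ((MeromorphicAt.id a).sub (MeromorphicAt.const a a)).inv.mul hg.meromorphicAt
  refine ⟨hmero.congr hf.symm, ?_⟩
  obtain ⟨R, hR, hRf⟩ := Metric.eventually_nhds_iff_ball.1
    ((eventually_nhdsWithin_iff.1 hf).and hg.eventually_analyticAt)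
  filter_upwards [Ioo_mem_nhdsGT hR] with ρ hρ
  have hball : Metric.closedBall a ρ ⊆ Metric.ball a R := Metric.closedBall_subset_ball hρ.2
  have hcongr : (∮ z in C(a, ρ), f z) = ∮ z in C(a, ρ), (z - a)⁻¹ • g z :=
    circleIntegral.integral_congr hρ.1.le fun z hz =>
      (hRf z (hball (Metric.sphere_subset_closedBall hz))).1 (Metric.ne_of_mem_sphere hz hρ.1.ne')
  have hg' : DifferentiableOn ℂ g (Metric.ball a R) := fun z hz =>
    (hRf z hz).2.differentiableAt.differentiableWithinAt
  rw [hcongr, (hg'.diffContOnCl_ball hball).circleIntegral_sub_inv_smul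
    (Metric.mem_ball_self hρ.1), smul_eq_mul, inv_mul_cancel_left₀ Complex.two_pi_I_ne_zero]

theorem hasResidueAt_div_of_hasDerivAt (hg : AnalyticAt ℂ g a) (hN : AnalyticAt ℂ N a)
    (hNa : N a = 0) (hN' : HasDerivAt N c a) (hc : c ≠ 0) :
    HasResidueAt (fun s => g s / N s) a (g a / c) := by
  obtain ⟨p, hp⟩ := hN
  have hslope : AnalyticAt ℂ (dslope N a) a := ⟨_, hp.has_fpower_series_dslope_fslope⟩
  have hslope_eq : dslope N a a = c := by rw [dslope_same, hN'.deriv]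
  rw [← hslope_eq]
  refine hasResidueAt_of_eventuallyEq (hg.div hslope (by rwa [hslope_eq])) ?_
  filter_upwards [self_mem_nhdsWithin] with s hs
  have hsa : s - a ≠ 0 := sub_ne_zero.2 hs
  rw [Pi.div_apply, dslope_of_ne _ hs, slope_def_field, hNa, sub_zero]
  field_simp

end Residue

section ZetaResidue

variable {d J Q : ℕ} {r : Fin J → ℝ} {D g ε : ℝ} {c : ℕ → ℝ} {A : Set (Euc d)}
  {G : Fin Q → Set (Euc d)} {κ : Fin Q → ℕ → ℝ}

theorem differentiable_one_sub_sum_cpow (hr : ∀ j, 0 < r j) :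
    Differentiable ℂ fun s : ℂ => 1 - ∑ j, (r j : ℂ) ^ s :=
  (differentiable_const _).sub (Differentiable.fun_sum fun j _ =>
    differentiable_id.const_cpow (Or.inl (by exact_mod_cast (hr j).ne')))

theorem hasDerivAt_one_sub_sum_cpow (hr : ∀ j, 0 < r j) (D : ℝ) :
    HasDerivAt (fun s : ℂ => 1 - ∑ j, (r j : ℂ) ^ s)
      ((∑ j, r j ^ D * Real.log (r j)⁻¹ : ℝ) : ℂ) D := by
  have hderiv : ∀ j ∈ Finset.univ, HasDerivAt (fun s : ℂ => (r j : ℂ) ^ s)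
      ((r j : ℂ) ^ (D : ℂ) * Complex.log (r j) * 1) D := fun j _ =>
    (hasDerivAt_id (D : ℂ)).const_cpow (Or.inl (by exact_mod_cast (hr j).ne'))
  refine ((HasDerivAt.fun_sum hderiv).const_sub 1).congr_deriv ?_
  rw [← Finset.sum_neg_distrib, Complex.ofReal_sum]
  refine Finset.sum_congr rfl fun j _ => ?_
  rw [Real.log_inv, ← Complex.ofReal_log (hr j).le, ← Complex.ofReal_cpow (hr j).le]
  push_cast
  ring

theorem sum_rpow_mul_log_inv_pos (hr : ∀ j, 0 < r j) (hr₁ : ∀ j, r j < 1)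
    (hD : ∑ j, r j ^ D = 1) : 0 < ∑ j, r j ^ D * Real.log (r j)⁻¹ :=
  sum_mul_pos_of_sum_eq_one (fun j => Real.rpow_pos_of_pos (hr j) D) hD
    fun j => Real.log_pos ((one_lt_inv₀ (hr j)).2 (hr₁ j))

theorem hasResidueAt_scalingZeta_mul (hr : ∀ j, 0 < r j) (hr₁ : ∀ j, r j < 1)
    (hD : ∑ j, r j ^ D = 1) {H : ℂ → ℂ} {x : ℝ} (hH : AnalyticAt ℂ H D) (hx : H D = x) :
    HasResidueAt (fun s => scalingZeta r s * H s) D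
      ((x / ∑ j, r j ^ D * Real.log (r j)⁻¹ : ℝ) : ℂ) := by
  have hzero : 1 - ∑ j, (r j : ℂ) ^ (D : ℂ) = 0 := by
    simp only [← Complex.ofReal_cpow (hr _).le, ← Complex.ofReal_sum, hD, Complex.ofReal_one,
      sub_self]
  have hne : ((∑ j, r j ^ D * Real.log (r j)⁻¹ : ℝ) : ℂ) ≠ 0 :=
    Complex.ofReal_ne_zero.2 (sum_rpow_mul_log_inv_pos hr hr₁ hD).ne'
  simpa only [scalingZeta, one_div_mul_eq_div, Complex.ofReal_div, hx] using
    hasResidueAt_div_of_hasDerivAt hH ((differentiable_one_sub_sum_cpow hr).analyticAt D) hzero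
      (hasDerivAt_one_sub_sum_cpow hr D) hne

theorem hasResidueAt_scalingZeta (hr : ∀ j, 0 < r j) (hr₁ : ∀ j, r j < 1)
    (hD : ∑ j, r j ^ D = 1) :
    HasResidueAt (scalingZeta r) D ((1 / ∑ j, r j ^ D * Real.log (r j)⁻¹ : ℝ) : ℂ) := by
  simpa only [mul_one] using hasResidueAt_scalingZeta_mul (H := fun _ => 1) hr hr₁ hD
    analyticAt_const Complex.ofReal_one.symm

theorem analyticAt_sum_cpow_div (hg : 0 < g) (hD : ∀ m ∈ Finset.range (d + 1), (m : ℝ) ≠ D) :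
    AnalyticAt ℂ (fun s : ℂ => ∑ m ∈ Finset.range (d + 1),
      (g : ℂ) ^ (s - m) / (s - m) * (c m : ℂ)) D := by
  refine Finset.analyticAt_fun_sum _ fun m hm => ?_
  have hden : AnalyticAt ℂ (fun s : ℂ => s - m) D := analyticAt_id.sub analyticAt_const
  have hnum : Differentiable ℂ fun s : ℂ => (g : ℂ) ^ (s - m) :=
    (differentiable_id.sub_const _).const_cpow (Or.inl (by exact_mod_cast hg.ne'))
  refine ((hnum.analyticAt _).div hden ?_).mul analyticAt_const
  exact sub_ne_zero.2 (by exact_mod_cast (hD m hm).symm)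

theorem sum_cpow_div_ofReal (hg : 0 ≤ g) (D : ℝ) :
    ∑ m ∈ Finset.range (d + 1), (g : ℂ) ^ ((D : ℂ) - m) / ((D : ℂ) - m) * (c m : ℂ) =
      ((∑ m ∈ Finset.range (d + 1), g ^ (D - m) / (D - m) * c m : ℝ) : ℂ) := by
  simp only [Complex.ofReal_sum, Complex.ofReal_mul, Complex.ofReal_div, Complex.ofReal_cpow hg,
    Complex.ofReal_sub, Complex.ofReal_natCast]

theorem geometricZeta_mul_cpow (hε : 0 < ε) (s : ℂ) :
    geometricZeta r A c s ε * (ε : ℂ) ^ (s - (d : ℂ)) = scalingZeta r s *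
      ∑ m ∈ Finset.range (d + 1), (inradius A : ℂ) ^ (s - m) / (s - m) * (c m : ℂ) := by
  have hcancel : (ε : ℂ) ^ ((d : ℂ) - s) * (ε : ℂ) ^ (s - (d : ℂ)) = 1 := by
    rw [← Complex.cpow_add _ _ (by exact_mod_cast hε.ne'), sub_add_sub_cancel, sub_self,
      Complex.cpow_zero]
  rw [geometricZeta, mul_right_comm, mul_assoc (scalingZeta r s), hcancel, mul_one]

theorem hasResidueAt_geometricZeta (hr : ∀ j, 0 < r j) (hr₁ : ∀ j, r j < 1)
    (hD : ∑ j, r j ^ D = 1) (hDm : ∀ m ∈ Finset.range (d + 1), (m : ℝ) ≠ D)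
    (hA : 0 < inradius A) (hε : 0 < ε) :
    HasResidueAt (fun s => geometricZeta r A c s ε * (ε : ℂ) ^ (s - (d : ℂ))) D
      (((∑ m ∈ Finset.range (d + 1), inradius A ^ (D - m) / (D - m) * c m) /
        ∑ j, r j ^ D * Real.log (r j)⁻¹ : ℝ) : ℂ) := by
  simpa only [geometricZeta_mul_cpow hε] using hasResidueAt_scalingZeta_mul hr hr₁ hD
    (analyticAt_sum_cpow_div hA hDm) (sum_cpow_div_ofReal hA.le D)

theorem hasResidueAt_totalGeometricZeta (hr : ∀ j, 0 < r j)
    (hr₁ : ∀ j, r j < 1) (hD : ∑ j, r j ^ D = 1)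
    (hDm : ∀ m ∈ Finset.range (d + 1), (m : ℝ) ≠ D) (hG : ∀ q, 0 < inradius (G q)) (hε : 0 < ε) :
    HasResidueAt (fun s => totalGeometricZeta r G κ s ε * (ε : ℂ) ^ (s - (d : ℂ))) D
      (((∑ q, ∑ m ∈ Finset.range (d + 1), inradius (G q) ^ (D - m) / (D - m) * κ q m) /
        ∑ j, r j ^ D * Real.log (r j)⁻¹ : ℝ) : ℂ) := by
  simp only [totalGeometricZeta, Finset.sum_mul, geometricZeta_mul_cpow hε, ← Finset.mul_sum]
  refine hasResidueAt_scalingZeta_mul hr hr₁ hD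
    (Finset.analyticAt_fun_sum _ fun q _ => analyticAt_sum_cpow_div (hG q) hDm) ?_
  simp only [sum_cpow_div_ofReal (hG _).le, ← Complex.ofReal_sum]

end ZetaResidue

end Fractal

theorem theorem2_general {d J Q : ℕ} (hJ : 2 ≤ J)
    (φ : Fin J → Fractal.Euc d → Fractal.Euc d) (r : Fin J → ℝ)
    (hφ : ∀ j, Fractal.IsSimilitude (φ j) (r j))
    (F : Set (Fractal.Euc d)) (hF : Fractal.IsAttractor φ F)
    (hTSC : Fractal.TilesetCondition φ F)
    (hNTC : Fractal.NontrivialityCondition φ F)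
    (hPWC : Fractal.PearseWinterCondition F)
    (G : Fin Q → Set (Fractal.Euc d)) (hG : Fractal.IsOpenPartition φ F G)
    (κ : Fin Q → ℕ → ℝ) (hκ : ∀ q, Fractal.IsSteinerLike (G q) (κ q))
    (D : ℝ) (hD : D = Fractal.minkowskiDim F) (hDd : (d : ℝ) - 1 < D) :
    ∑ j, r j ^ D = 1 ∧
    Tendsto (fun ε : ℝ => (d : ℝ) - Real.log (Fractal.tubeVolume F ε) / Real.log ε)
      (𝓝[>] 0) (𝓝 D) ∧
    ∃ (M : ℝ) (μ : Fin Q → ℝ),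
      (∀ ε : ℝ, 0 < ε → Fractal.HasResidueAt
        (fun s => Fractal.totalGeometricZeta r G κ s ε * (ε : ℂ) ^ (s - (d : ℂ))) D M) ∧
      (∀ q, ∀ ε : ℝ, 0 < ε → Fractal.HasResidueAt
        (fun s => Fractal.geometricZeta r (G q) (κ q) s ε * (ε : ℂ) ^ (s - (d : ℂ)))
        D (μ q)) ∧
      M = ∑ q, μ q ∧
      (∃ ρ : ℝ, Fractal.HasResidueAt (Fractal.scalingZeta r) D ρ ∧
        M = ρ * ∑ q, ∑ m ∈ Finset.range (d + 1),
          Fractal.inradius (G q) ^ (D - m) / (D - m) * κ q m) ∧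
      M = (∑ q, ∑ m ∈ Finset.range (d + 1),
          Fractal.inradius (G q) ^ (D - m) / (D - m) * κ q m) /
        ∑ j, r j ^ D * Real.log (r j)⁻¹ ∧
      (¬ Fractal.IsLatticeType r → Fractal.HasMinkowskiContent F M) ∧
      (Fractal.IsLatticeType r →
        ¬ Fractal.IsMinkowskiMeasurable F ∧ Fractal.HasAverageMinkowskiContent F M) := by
  have hr (j : Fin J) : 0 < r j := (hφ j).1
  have hr₁ (j : Fin J) : r j < 1 := (hφ j).2.1
  have : Nontrivial (Fin J) := Fin.nontrivial_iff_two_le.2 hJ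
  have : Nonempty (Fin d) := Fin.pos_iff_nonempty.1 (hTSC.dim_pos hJ)
  have hb := hF.2.1.isBounded
  have h := hG.isSelfSimilarTube hφ hF hTSC hPWC hκ
  obtain ⟨D₀, hD₀, hD₀d, hmoran⟩ := Fractal.exists_moran_exponent hr
    (hG.sum_pow_lt_one hφ hF hTSC hNTC (hPWC.isCompact_convexHull hb))
  obtain rfl : D = D₀ := hD.trans (h.minkowskiDim_eq hb hmoran hD₀.le hD₀d (hD ▸ hDd))
  have hDm (m : ℕ) (hm : m ∈ Finset.range (d + 1)) : (m : ℝ) ≠ D :=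
    Fractal.natCast_ne_of_mem_range hDd hD₀d hm
  have hg (q : Fin Q) : 0 < Fractal.inradius (G q) := (h.isDiphase q).pos
  refine ⟨hmoran, h.tendsto_sub_log_div_log hmoran hDd hD₀d, _, fun q => _,
    fun ε => Fractal.hasResidueAt_totalGeometricZeta hr hr₁ hmoran hDm hg,
    fun q ε => Fractal.hasResidueAt_geometricZeta hr hr₁ hmoran hDm (hg q),
    Finset.sum_div _ _ _,
    ⟨_, Fractal.hasResidueAt_scalingZeta hr hr₁ hmoran, (one_div_mul_eq_div _ _).symm⟩, rfl, ?_⟩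
  subst hD
  exact ⟨h.hasMinkowskiContent hmoran hDd hD₀d, fun hlat =>
    ⟨h.not_isMinkowskiMeasurable hmoran hDd hD₀d hlat, h.tendsto_average_outer hmoran hDd hD₀d⟩⟩

theorem theorem2 {d J Q : ℕ} (hJ : 2 ≤ J)
    (φ : Fin J → Fractal.Euc d → Fractal.Euc d) (r : Fin J → ℝ)
    (hφ : ∀ j, Fractal.IsSimilitude (φ j) (r j))
    (F : Set (Fractal.Euc d)) (hF : Fractal.IsAttractor φ F)
    (hdim : Module.finrank ℝ (vectorSpan ℝ (convexHull ℝ F)) = d)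
    (hTSC : Fractal.TilesetCondition φ F)
    (hNTC : Fractal.NontrivialityCondition φ F)
    (hPWC : Fractal.PearseWinterCondition F)
    (G : Fin Q → Set (Fractal.Euc d)) (hG : Fractal.AreGenerators φ F G)
    (κ : Fin Q → ℕ → ℝ) (hκ : ∀ q, Fractal.IsSteinerLike (G q) (κ q))
    (D : ℝ) (hD : D = Fractal.minkowskiDim F) (hDd : (d : ℝ) - 1 < D) :
    -- `D` solves the Moran equation, and it is the Minkowski dimension also as a limit
    ∑ j, r j ^ D = 1 ∧
    Tendsto (fun ε : ℝ => (d : ℝ) - Real.log (Fractal.tubeVolume F ε) / Real.log ε)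
      (𝓝[>] 0) (𝓝 D) ∧
    -- `M` is the residue at `D` of `ζ_T(s, ε) ε ^ (s - d)`, and `μ q` is the contribution
    -- of the generator `G q` to it
    ∃ (M : ℝ) (μ : Fin Q → ℝ),
      (∀ ε : ℝ, 0 < ε → Fractal.HasResidueAt
        (fun s => Fractal.totalGeometricZeta r G κ s ε * (ε : ℂ) ^ (s - (d : ℂ))) D M) ∧
      (∀ q, ∀ ε : ℝ, 0 < ε → Fractal.HasResidueAt
        (fun s => Fractal.geometricZeta r (G q) (κ q) s ε * (ε : ℂ) ^ (s - (d : ℂ)))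
        D (μ q)) ∧
      M = ∑ q, μ q ∧
      (∃ ρ : ℝ, Fractal.HasResidueAt (Fractal.scalingZeta r) D ρ ∧
        M = ρ * ∑ q, ∑ m ∈ Finset.range (d + 1),
          Fractal.inradius (G q) ^ (D - m) / (D - m) * κ q m) ∧
      M = (∑ q, ∑ m ∈ Finset.range (d + 1),
          Fractal.inradius (G q) ^ (D - m) / (D - m) * κ q m) /
        ∑ j, r j ^ D * Real.log (r j)⁻¹ ∧
      -- part I
      (¬ Fractal.IsLatticeType r → Fractal.HasMinkowskiContent F M) ∧
      -- part II
      (Fractal.IsLatticeType r →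
        ¬ Fractal.IsMinkowskiMeasurable F ∧ Fractal.HasAverageMinkowskiContent F M) :=
  theorem2_general hJ φ r hφ F hF hTSC hNTC hPWC G hG.isOpenPartition κ hκ D hD hDd
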